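/- Let $T$ be a finite set of primitive tests, let $\mathit{BA}$ be the free Boolean algebra on $T$ (Boolean expressions over $T$ modulo the axioms of Boolean algebra), and let $\mathit{At}$ be its set of atoms. The theory $\mathsf{GC}$ of \emph{guarded convex algebra} has a constant $0$, a binary operation $+_b$ for every $b\in\mathit{BA}$ and a binary operation $\oplus_p$ for every $p\in[0,1]$, and is axiomatized, for all $b,c\in\mathit{BA}$ and $p,q\in[0,1]$, by \begin{itemize} \item $x+_\top y=x$, $\quad x+_b x=x$, $\quad x+_b y=y+_{\neg b}x$, $\quad (x+_b y)+_c z=x+_{b\wedge c}(y+_c z)$; \item $x\oplus_1 y=x$, $\quad x\oplus_p x=x$, $\quad x\oplus_p y=y\oplus_{1-p}x$, $\quad (x\oplus_p y)\oplus_q z=x\oplus_{pq}\bigl(y\oplus_{q(1-p)/(1-pq)}z\bigr)$ if $pq<1$; \item $x\oplus_p(y+_b z)=(x\oplus_p y)+_b(x\oplus_p z)$. \end{itemize} Write $\mathsf{GC}\vdash t=s$ for derivability in equational logic, and $\mathcal D(\bot+X)$ for the set of finitely supported probability distributions on $\{\bot\}\sqcup X$. Then the following hold. \begin{enumerate} \item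 \emph{($\mathsf{GC}$ is supported.)} Let $MX=\mathcal D(\bot+X)^{\mathit{At}}$, with functorial action by pushforward, $\eta_X(x)(\alpha)=\delta_x$, $0^\rho(\alpha)=\delta_\bot$, $(\chi_1+_b^\rho\chi_2)(\alpha)=\chi_1(\alpha)$ if $\alpha\le b$ and $\chi_2(\alpha)$ otherwise, and $(\chi_1\oplus_p^\rho\chi_2)(\alpha)=p\chi_1(\alpha)+(1-p)\chi_2(\alpha)$. Then $(M,\eta,\rho)$ is a free-algebra construction for $\mathsf{GC}$: $M$ is a functor, $\eta$ and $\rho$ are natural, each $(MX,\rho_X)$ satisfies $\mathsf{GC}$, and every map from $X$ to a $\mathsf{GC}$-algebra extends uniquely along $\eta_X$ to a homomorphism from $MX$. Moreover $\mathsf{supp}_X(\chi)=\bigcup_{\alpha\in\mathit{At}}\{x\in X\mid\chi(\alpha)(x)>0\}$ is a support: it is a natural transformation from $M$ to the finite powerset functor with $\mathsf{supp}(\eta(x))=\{x\}$ and $\mathsf{supp}(\sigma^\rho(t_1^\rho,\dots,t_n^\rho))\subseteq\bigcup_i\mathsf{supp}(t_i^\rho)$ for every operation $\sigma$ and all terms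 $t_i$, where $t^\rho$ denotes the evaluation of a term $t$ over $X$ in $MX$ under $\eta_X$. In particular $\mathsf{GC}$ is supported, i.e. it has a free-algebra construction with a support. \item \emph{($\mathsf{GC}$ is malleable.)} For every set $X$, every partition $X=U\sqcup V$ (either part may be empty) and every term $t$ over $X$, there are terms $t_1$ over $U$ and $t_2$ over $V$ and a term $s(u,v)$ in two variables with $\mathsf{GC}\vdash t=s(t_1,t_2)$. Moreover, $t_1,t_2,s$ can be chosen so that $s$ is given atom-wise as follows: for $\alpha\in\mathit{At}$, let $r_\alpha=t^\rho(\alpha)(X)$ be the total mass on $X$ and, if $r_\alpha>0$, let $p_\alpha=t^\rho(\alpha)(U)/r_\alpha$; then $s^\rho(\alpha)=r_\alpha\bigl(p_\alpha\delta_u+(1-p_\alpha)\delta_v\bigr)+(1-r_\alpha)\delta_\bot$, to be read as $\delta_\bot$ if $r_\alpha=0$. \item \emph{($\mathsf{GC}$ is not skew associative.)} If $T\neq\emptyset$, then it is not the case that for all binary operations $\sigma_1,\sigma_2$ of $\mathsf{GC}$ there are binary operations $\tau_1,\tau_2$ of $\mathsf{GC}$ with $\mathsf{GC}\vdash\sigma_1(x,\sigma_2(y,z))=\tau_1(\tau_2(x,y),z)$.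 \end{enumerate} -/

import Mathlib

universe u v w

/-! ## Equational logic -/

/-- A signature: a set of operation symbols with arities. -/
structure Sig where
  Op : Type u
  ar : Op → ℕ

namespace Sig

/-- The set of `S`-terms over `X`. -/
inductive Term (S : Sig.{u}) (X : Type v) : Type (max u v)
  | var (x : X) : Term S X
  | op (σ : S.Op) (args : Fin (S.ar σ) → Term S X) : Term S X

namespace Term

variable {S : Sig.{u}} {X : Type v} {Y : Type w}

/-- Simultaneous substitution `t(ν)`. -/
def subst (ν : X → Term S Y) : Term S X → Term S Y
  | var x => ν x
  | op σ args => op σ fun i => (args i).subst ν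

/-- Renaming of variables. -/
def rename (f : X → Y) (t : Term S X) : Term S Y := t.subst fun x => var (f x)

/-- The term `σ(t₁, t₂)` for a binary operation symbol `σ`. -/
def bin (σ : S.Op) (h : S.ar σ = 2) (t₁ t₂ : Term S X) : Term S X :=
  op σ fun i => ![t₁, t₂] (Fin.cast h i)

end Term

/-- An `S`-algebra structure on a set `A`. -/
def Alg (S : Sig.{u}) (A : Type v) : Type (max u v) :=
  (σ : S.Op) → (Fin (S.ar σ) → A) → A

/-- Evaluation of a term in an algebra, under an assignment of its variables. -/
def Alg.eval {S : Sig.{u}} {A : Type v} (ρ : S.Alg A) {X : Type w} (e : X → A) : S.Term X → A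
  | .var x => e x
  | .op σ args => ρ σ fun i => ρ.eval e (args i)

/-- Homomorphisms of `S`-algebras. -/
def IsHom {S : Sig.{u}} {A : Type v} {B : Type w} (ρ : S.Alg A) (μ : S.Alg B) (h : A → B) :
    Prop :=
  ∀ (σ : S.Op) (a : Fin (S.ar σ) → A), h (ρ σ a) = μ σ fun i => h (a i)

/-- A set of formal equations over the countable set of variables `Var = ℕ`. -/
def Eqns (S : Sig.{u}) : Type u := S.Term ℕ → S.Term ℕ → Prop

/-- `E ⊢ t = s`: derivability in equational logic, for terms over an arbitrary set `X`. The axioms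
may be used under any substitution of terms for their variables. -/
inductive Eqns.Derives {S : Sig.{u}} (E : S.Eqns) {X : Type v} : S.Term X → S.Term X → Prop
  | ax {l r : S.Term ℕ} (h : E l r) (ν : ℕ → S.Term X) : Derives E (l.subst ν) (r.subst ν)
  | refl (t : S.Term X) : Derives E t t
  | symm {t s : S.Term X} : Derives E t s → Derives E s t
  | trans {t s r : S.Term X} : Derives E t s → Derives E s r → Derives E t r
  | congr (σ : S.Op) {a b : Fin (S.ar σ) → S.Term X} :
      (∀ i, Derives E (a i) (b i)) → Derives E (.op σ a) (.op σ b)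

/-- An algebra satisfies a set of equations if each of them holds under all assignments. -/
def Alg.Satisfies {S : Sig.{u}} {A : Type v} (ρ : S.Alg A) (E : S.Eqns) : Prop :=
  ∀ l r, E l r → ∀ e : ℕ → A, ρ.eval e l = ρ.eval e r

/-! ## Free-algebra constructions and supports -/

/-- The data of a triple `(M, η, ρ)`: an action of `M` on sets and functions, and families
`η_X : X → M X` and `ρ_X : S (M X) → M X`. -/
structure Triple (S : Sig.{u}) where
  obj : Type v → Type v
  map : {X Y : Type v} → (X → Y) → obj X → obj Y
  unit : {X : Type v} → X → obj X
  alg : (X : Type v) → S.Alg (obj X)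

/-- The triple is a free-algebra construction for the theory axiomatized by `E`. -/
structure Triple.IsFreeAlgebraConstruction {S : Sig.{u}} (M : Triple.{u, v} S) (E : S.Eqns) :
    Prop where
  map_id : ∀ (X : Type v) (m : M.obj X), M.map id m = m
  map_comp : ∀ (X Y Z : Type v) (f : X → Y) (g : Y → Z) (m : M.obj X),
    M.map (g ∘ f) m = M.map g (M.map f m)
  unit_natural : ∀ (X Y : Type v) (f : X → Y) (x : X), M.map f (M.unit x) = M.unit (f x)
  alg_natural : ∀ (X Y : Type v) (f : X → Y), IsHom (M.alg X) (M.alg Y) (M.map f)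
  satisfies : ∀ X : Type v, (M.alg X).Satisfies E
  existsUnique_extension : ∀ (X Y : Type v) (μ : S.Alg Y), μ.Satisfies E → ∀ f : X → Y,
    ∃! h : M.obj X → Y, IsHom (M.alg X) μ h ∧ ∀ x, h (M.unit x) = f x

/-- A support: a natural transformation from `M` to the finite powerset functor such that
`supp ∘ η = {-}` and `supp (σ(t₁, …, tₙ)) ⊆ supp t₁ ∪ ⋯ ∪ supp tₙ`. -/
structure Triple.IsSupport {S : Sig.{u}} (M : Triple.{u, v} S)
    (supp : (X : Type v) → M.obj X → Set X) : Prop where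
  finite : ∀ (X : Type v) (m : M.obj X), (supp X m).Finite
  natural : ∀ (X Y : Type v) (f : X → Y) (m : M.obj X), supp Y (M.map f m) = f '' supp X m
  unit : ∀ (X : Type v) (x : X), supp X (M.unit x) = {x}
  op_subset : ∀ (X : Type v) (σ : S.Op) (t : Fin (S.ar σ) → S.Term X),
    supp X ((M.alg X).eval M.unit (.op σ t)) ⊆ ⋃ i, supp X ((M.alg X).eval M.unit (t i))

/-- The theory axiomatized by `E` is supported: its free-algebra construction has a support. -/
def Eqns.Supported {S : Sig.{u}} (E : S.Eqns) : Prop :=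
  ∃ (M : Triple.{u, v} S) (supp : (X : Type v) → M.obj X → Set X),
    M.IsFreeAlgebraConstruction E ∧ M.IsSupport supp

/-! ## Malleability and skew associativity -/

/-- For a partition `X = U + V`, the term `s(t₁, t₂)` over `X`, where `s = s(u, v)` is a term in
two variables and `t₁`, `t₂` are terms over `U` and `V`. -/
def Term.split {S : Sig.{u}} {X : Type v} {U V : Set X} (s : S.Term (Fin 2)) (t₁ : S.Term U)
    (t₂ : S.Term V) : S.Term X :=
  s.subst ![t₁.rename Subtype.val, t₂.rename Subtype.val]

/-- The theory axiomatized by `E` is malleable. -/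
def Eqns.Malleable {S : Sig.{u}} (E : S.Eqns) : Prop :=
  ∀ (X : Type v) (U V : Set X), IsCompl U V → ∀ t : S.Term X,
    ∃ (t₁ : S.Term U) (t₂ : S.Term V) (s : S.Term (Fin 2)), E.Derives t (s.split t₁ t₂)

/-- Skew associativity: for all binary `σ₁, σ₂` there are binary `τ₁, τ₂` such that
`σ₁(x, σ₂(y, z)) = τ₁(τ₂(x, y), z)` is derivable. -/
def Eqns.SkewAssociative {S : Sig.{u}} (E : S.Eqns) : Prop :=
  ∀ (σ₁ σ₂ : S.Op) (h₁ : S.ar σ₁ = 2) (h₂ : S.ar σ₂ = 2),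
    ∃ (τ₁ τ₂ : S.Op) (k₁ : S.ar τ₁ = 2) (k₂ : S.ar τ₂ = 2),
      E.Derives (X := ℕ)
        (.bin σ₁ h₁ (.var 0) (.bin σ₂ h₂ (.var 1) (.var 2)))
        (.bin τ₁ k₁ (.bin τ₂ k₂ (.var 0) (.var 1)) (.var 2))

end Sig

/-! ## The free Boolean algebra on a set of primitive tests -/

/-- Boolean expressions over the primitive tests `T`. -/
inductive BExp (T : Type u) : Type u
  | test (a : T) : BExp T
  | bot : BExp T
  | and (b c : BExp T) : BExp T
  | not (b : BExp T) : BExp T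

namespace BExp

variable {T : Type u}

/-- Disjunction, as an abbreviation. -/
def or (b c : BExp T) : BExp T := not (and (not b) (not c))

/-- Provable equivalence from the axioms of Boolean algebra. -/
inductive Equiv : BExp T → BExp T → Prop
  | refl (b) : Equiv b b
  | symm {b c} : Equiv b c → Equiv c b
  | trans {b c d} : Equiv b c → Equiv c d → Equiv b d
  | and_congr {b b' c c'} : Equiv b b' → Equiv c c' → Equiv (and b c) (and b' c')
  | not_congr {b b'} : Equiv b b' → Equiv (not b) (not b')
  | not_not (b) : Equiv (not (not b)) b
  | and_comm (b c) : Equiv (and b c) (and c b)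
  | and_assoc (b c d) : Equiv (and (and b c) d) (and b (and c d))
  | and_or_self (b c) : Equiv (and b (or b c)) b
  | and_or (b c d) : Equiv (and b (or c d)) (or (and b c) (and b d))
  | and_not (b) : Equiv (and b (not b)) bot

instance setoid (T : Type u) : Setoid (BExp T) :=
  ⟨Equiv, Equiv.refl, Equiv.symm, Equiv.trans⟩

end BExp

/-- The free Boolean algebra on `T`: Boolean expressions modulo the axioms of Boolean algebra. -/
def BA (T : Type u) : Type u := Quotient (BExp.setoid T)

namespace BA

variable {T : Type u}

/-- The class of a Boolean expression. -/
def mk (b : BExp T) : BA T := Quotient.mk _ b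

/-- Conjunction. -/
def conj : BA T → BA T → BA T := Quotient.map₂ .and fun _ _ h _ _ k => .and_congr h k

/-- Negation. -/
def neg : BA T → BA T := Quotient.map .not fun _ _ h => .not_congr h

/-- Disjunction. -/
def disj (b c : BA T) : BA T := neg (conj (neg b) (neg c))

theorem neg_neg (b : BA T) : neg (neg b) = b :=
  Quotient.inductionOn b fun b => Quotient.sound (.not_not b)

theorem conj_comm (b c : BA T) : conj b c = conj c b :=
  Quotient.inductionOn₂ b c fun b c => Quotient.sound (.and_comm b c)

theorem conj_assoc (b c d : BA T) : conj (conj b c) d = conj b (conj c d) :=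
  Quotient.inductionOn₃ b c d fun b c d => Quotient.sound (.and_assoc b c d)

theorem conj_disj_self (b c : BA T) : conj b (disj b c) = b :=
  Quotient.inductionOn₂ b c fun b c => Quotient.sound (.and_or_self b c)

theorem conj_disj (b c d : BA T) : conj b (disj c d) = disj (conj b c) (conj b d) :=
  Quotient.inductionOn₃ b c d fun b c d => Quotient.sound (.and_or b c d)

theorem conj_neg (b : BA T) : conj b (neg b) = mk .bot :=
  Quotient.inductionOn b fun b => Quotient.sound (.and_not b)

theorem disj_comm (b c : BA T) : disj b c = disj c b := by
  rw [disj, conj_comm, ← disj]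

theorem disj_conj_self (b c : BA T) : disj b (conj b c) = b := by
  have h := conj_disj_self (neg b) (neg c)
  rw [disj, neg_neg, neg_neg] at h
  rw [disj, h, neg_neg]

theorem conj_idem (b : BA T) : conj b b = b := by
  have h := conj_disj_self b (conj b b)
  rwa [disj_conj_self] at h

theorem bot_conj (b : BA T) : conj (mk .bot) b = mk .bot := by
  rw [← conj_neg b, conj_comm, ← conj_assoc, conj_idem]

theorem conj_top (b : BA T) : conj b (neg (mk .bot)) = b := by
  have h := conj_disj_self b (neg b)
  rwa [disj, neg_neg, conj_comm (neg b) b, conj_neg] at h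

/-- The Boolean algebra structure; its order is given by `b ≤ c` if `b ∧ c = b`. -/
instance : BooleanAlgebra (BA T) :=
  let L : Lattice (BA T) :=
    { le := fun b c => conj b c = b
      le_refl := conj_idem
      le_trans := fun b c d h k => by rw [← h, conj_assoc, k]
      le_antisymm := fun b c h k => by rw [← h, conj_comm, k]
      sup := disj
      inf := conj
      inf_le_left := fun b c => by rw [conj_comm, ← conj_assoc, conj_idem]
      inf_le_right := fun b c => by rw [conj_assoc, conj_idem]
      le_inf := fun b c d h k => by rw [← conj_assoc, h, k]
      le_sup_left := conj_disj_self
      le_sup_right := fun b c => by rw [disj_comm, conj_disj_self]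
      sup_le := fun b c d h k => by
        rw [conj_comm, conj_disj, conj_comm d b, conj_comm d c, h, k] }
  { L with
    le_sup_inf := (DistribLattice.ofInfSupLe fun b c d : BA T =>
      (conj_disj b c d).le).le_sup_inf
    compl := neg
    bot := mk .bot
    top := neg (mk .bot)
    inf_compl_le_bot := fun b => (conj_neg b).le
    top_le_sup_compl := fun b => by
      change neg (mk .bot) ≤ neg (conj (neg b) (neg (neg b)))
      rw [conj_neg]
    le_top := conj_top
    bot_le := bot_conj }

end BA

/-- The atoms of the Boolean algebra of tests. -/
abbrev At (T : Type u) : Type u := {α : BA T // IsAtom α}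

/-! ## Guarded convex algebra -/

/-- The operation symbols of guarded convex algebra: a constant `0`, a binary `+_b` for each
`b ∈ BA`, and a binary `⊕_p` for each `p ∈ [0, 1]`. -/
inductive GCOp (T : Type u) : Type u
  | zero : GCOp T
  | guard (b : BA T) : GCOp T
  | conv (p : unitInterval) : GCOp T

/-- The signature of guarded convex algebra. -/
abbrev GCSig (T : Type u) : Sig.{u} where
  Op := GCOp T
  ar
    | .zero => 0
    | .guard _ => 2
    | .conv _ => 2

namespace GC

variable {T : Type u} {X : Type v}

/-- The constant `0`. -/
def zero : (GCSig T).Term X := .op GCOp.zero Fin.elim0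

/-- The term `t₁ +_b t₂`. -/
def guard (b : BA T) (t₁ t₂ : (GCSig T).Term X) : (GCSig T).Term X :=
  .op (GCOp.guard b) ![t₁, t₂]

/-- The term `t₁ ⊕_p t₂`. -/
def conv (p : unitInterval) (t₁ t₂ : (GCSig T).Term X) : (GCSig T).Term X :=
  .op (GCOp.conv p) ![t₁, t₂]

/-- The variables `x`, `y`, `z` of the axioms. -/
abbrev x : (GCSig T).Term ℕ := .var 0
abbrev y : (GCSig T).Term ℕ := .var 1
abbrev z : (GCSig T).Term ℕ := .var 2

/-- The axioms of guarded algebra. -/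
inductive GA : (GCSig T).Eqns
  | top : GA (guard ⊤ x y) x
  | idem (b : BA T) : GA (guard b x x) x
  | comm (b : BA T) : GA (guard b x y) (guard bᶜ y x)
  | assoc (b c : BA T) : GA (guard c (guard b x y) z) (guard (b ⊓ c) x (guard c y z))

/-- The axioms of convex algebra. In `assoc`, the side conditions say `r = q(1-p)/(1-pq)`, which
always lies in `[0, 1]`. -/
inductive CA : (GCSig T).Eqns
  | one : CA (conv 1 x y) x
  | idem (p : unitInterval) : CA (conv p x x) x
  | comm (p : unitInterval) : CA (conv p x y) (conv (unitInterval.symm p) y x)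
  | assoc (p q r : unitInterval) (hpq : (p * q : ℝ) < 1)
      (hr : (r : ℝ) = q * (1 - p) / (1 - p * q)) :
      CA (conv q (conv p x y) z) (conv (p * q) x (conv r y z))

/-- The distribution law. -/
inductive Dist : (GCSig T).Eqns
  | dist (p : unitInterval) (b : BA T) :
      Dist (conv p x (guard b y z)) (guard b (conv p x y) (conv p x z))

end GC

/-- The axioms of the theory of guarded convex algebra. -/
def GC (T : Type u) : (GCSig T).Eqns := fun l r => GC.GA l r ∨ GC.CA l r ∨ GC.Dist l r

/-! ## The free-algebra construction for guarded convex algebra -/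

open Convexity in
/-- `𝒟 (⊥ + X)`: finitely supported probability distributions on `⊥ + X`. -/
abbrev SubDist (X : Type v) : Type v := StdSimplex ℝ (Option X)

namespace SubDist

variable {X : Type v}

/-- The Dirac distribution at `x ∈ X`. -/
noncomputable def dirac (x : X) : SubDist X := .single (some x)

/-- The Dirac distribution at `⊥`. -/
noncomputable def diracBot : SubDist X := .single none

/-- `p θ₁ + (1 - p) θ₂`. -/
noncomputable def mix (p : unitInterval) (θ₁ θ₂ : SubDist X) : SubDist X :=
  Convexity.convexCombPair (p : ℝ) (1 - p) p.2.1 (sub_nonneg.2 p.2.2) (add_sub_cancel _ _) θ₁ θ₂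

/-- `θ(U) = ∑_{x ∈ U} θ(x)` for `U ⊆ X`, a finite sum since `θ` is finitely supported. -/
noncomputable def mass (θ : SubDist X) (U : Set X) : ℝ := ∑ᶠ x ∈ U, θ.weights (some x)

end SubDist

/-- The set `𝒟 (⊥ + X) ^ At`. -/
abbrev GCFree (T : Type u) (X : Type v) : Type (max u v) := At T → SubDist X

namespace GCFree

variable {T : Type u}

/-- The unit `η_X(x)(α) = δ_x`. -/
noncomputable def unit {X : Type v} (x : X) : GCFree T X := fun _ => SubDist.dirac x

open Classical in
/-- The operations on `𝒟 (⊥ + X) ^ At`. -/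
noncomputable def alg (T : Type u) (X : Type v) : (GCSig T).Alg (GCFree T X)
  | .zero, _ => fun _ => SubDist.diracBot
  | .guard b, (χ : Fin 2 → GCFree T X) => fun α => if α.1 ≤ b then χ 0 α else χ 1 α
  | .conv p, (χ : Fin 2 → GCFree T X) => fun α => SubDist.mix p (χ 0 α) (χ 1 α)

/-- The triple `(𝒟 (⊥ + (-)) ^ At, η, ρ)`. -/
noncomputable def triple (T : Type u) : Sig.Triple.{u, u} (GCSig T) where
  obj X := GCFree T X
  map f χ := fun α => (χ α).map (Option.map f)
  unit := unit
  alg := alg T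

/-- `supp_X(χ) = ⋃_α {x ∈ X ∣ χ(α)(x) > 0}`. -/
def supp (X : Type v) (χ : GCFree T X) : Set X := ⋃ α, {x | 0 < (χ α).weights (some x)}

end GCFree

/-! Everything rests on showing that `𝒟 (⊥ + X) ^ At` is free, and this splits into a Boolean and a
convex half. For the Boolean half, `AgreeOn g b` plays the role of equality on the region `b`. As
`BA T` is finite, an element of a guarded algebra is determined by its behaviour under the atoms
(`ext_atoms`), and arbitrary behaviours under the atoms can be glued (`exists_glue`). For the convex
half, a convex algebra embeds into its cone, where the convex laws become those of a commutative
monoid. Finite sums then give barycentres, hence extensions along point masses. They are unique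
because the cone over a simplex embeds into finitely supported functions (`eq_barycentre`). The
distribution law makes agreement a congruence for `⊕_p`, so barycentres taken at each atom glue to
the unique homomorphic extension.

Since terms modulo derivability form a model, freeness yields completeness (`derives_of_eval_eq`)
and shows that every element of the free algebra is the value of a term (`exists_eval_eq`).
Malleability thus becomes a decomposition of one subdistribution at each atom: normalize it on `U`
and on `V`, and let `s` record the two masses. For skew associativity, take `x ⊕_{1/2} (y +_b z)`:
the weight of `z` is `0` at an atom below `b` and `1/2` at an atom below `bᶜ`. In `τ₁(τ₂(x, y), z)`,
a guard `τ₁` gives `z` weight `0` or `1`, and a convex `τ₁` gives it the same weight at all atoms.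
-/

/-! ## Guarded algebras over a Boolean algebra -/

/-- The laws of guarded algebra for a family of binary operations indexed by tests. -/
structure GuardLaws {B : Type u} [BooleanAlgebra B] {A : Type v} (g : B → A → A → A) : Prop where
  top : ∀ x y, g ⊤ x y = x
  idem : ∀ b x, g b x x = x
  comm : ∀ b x y, g b x y = g bᶜ y x
  assoc : ∀ b c x y z, g c (g b x y) z = g (b ⊓ c) x (g c y z)

namespace GuardLaws

variable {B : Type u} [BooleanAlgebra B] {A : Type v} {g : B → A → A → A}

theorem bot (h : GuardLaws g) (x y : A) : g ⊥ x y = y := by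
  rw [h.comm, compl_bot, h.top]

theorem guard_guard_right (h : GuardLaws g) (b : B) (x y z : A) :
    g b x (g b y z) = g b x z := by
  rw [h.comm b x (g b y z), h.assoc, inf_compl_self, h.bot, ← h.comm]

theorem guard_guard_left (h : GuardLaws g) (b : B) (x y z : A) :
    g b (g b x y) z = g b x z := by
  rw [h.assoc, inf_idem, h.guard_guard_right]

/-- By De Morgan and `comm`, associativity, which composes tests by meet, also governs joins. -/
theorem sup (h : GuardLaws g) (b c : B) (x y : A) : g (b ⊔ c) x y = g b x (g c x y) := by
  rw [h.comm (b ⊔ c), compl_sup, inf_comm, h.comm b x, h.comm c x, h.assoc, h.idem]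

end GuardLaws

/-! ### Agreement under a test, and gluing along atoms -/

/-- Two elements agree under the test `b`. -/
def AgreeOn {B : Type u} {A : Type v} (g : B → A → A → A) (b : B) (x y : A) : Prop :=
  ∀ c, g b x c = g b y c

namespace AgreeOn

variable {B : Type u} {A : Type v} {g : B → A → A → A} {a b : B} {x y z x' y' : A}

theorem refl (x : A) : AgreeOn g b x x := fun _ => rfl

theorem symm (h : AgreeOn g b x y) : AgreeOn g b y x := fun c => (h c).symm

theorem trans (h : AgreeOn g b x y) (k : AgreeOn g b y z) : AgreeOn g b x z :=
  fun c => (h c).trans (k c)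

end AgreeOn

namespace GuardLaws

variable {B : Type u} [BooleanAlgebra B] {A : Type v} {g : B → A → A → A} {a b : B}
  {x y x' y' : A}

/-- A single else-branch `c` suffices, because `guard_guard_left` lets it be overwritten by any
other. -/
theorem agreeOn_of_eq (h : GuardLaws g) {c : A} (e : g b x c = g b y c) : AgreeOn g b x y :=
  fun d => by rw [← h.guard_guard_left b x c, e, h.guard_guard_left]

theorem agreeOn_left (h : GuardLaws g) (hab : a ≤ b) (x y : A) : AgreeOn g a (g b x y) x :=
  fun c => by rw [h.assoc, inf_eq_right.2 hab, h.guard_guard_right]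

theorem agreeOn_right (h : GuardLaws g) (hab : a ≤ bᶜ) (x y : A) : AgreeOn g a (g b x y) y := by
  rw [h.comm]
  exact h.agreeOn_left hab y x

theorem agreeOn_sup (h : GuardLaws g) (ha : AgreeOn g a x y) (hb : AgreeOn g b x y) :
    AgreeOn g (a ⊔ b) x y := fun c => by
  rw [h.sup, h.sup, ha, hb]

/-- An atom lies below `b` or below `bᶜ`, so only one branch is visible under it. -/
theorem agreeOn_guard (h : GuardLaws g) (ha : IsAtom a) (b : B) (hx : AgreeOn g a x x')
    (hy : AgreeOn g a y y') : AgreeOn g a (g b x y) (g b x' y') := by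
  by_cases hab : a ≤ b
  · exact ((h.agreeOn_left hab x y).trans hx).trans (h.agreeOn_left hab x' y').symm
  · have hab' : a ≤ bᶜ := le_compl_iff_disjoint_right.2 (ha.not_le_iff_disjoint.1 hab)
    exact ((h.agreeOn_right hab' x y).trans hy).trans (h.agreeOn_right hab' x' y').symm

variable [Finite B]

/-- Elements that agree under all atoms are equal. -/
theorem ext_atoms (h : GuardLaws g) (hxy : ∀ a, IsAtom a → AgreeOn g a x y) : x = y := by
  classical
  -- Agreement passes to finite joins. The join of all atoms is `⊤`, and agreement under `⊤` is
  -- equality.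
  have key : ∀ s : Finset B, (∀ a ∈ s, IsAtom a) → AgreeOn g (s.sup id) x y := by
    intro s
    induction s using Finset.induction_on with
    | empty => exact fun _ c => by rw [Finset.sup_empty, h.bot, h.bot]
    | insert a s _ ih =>
      intro hs
      rw [Finset.sup_insert]
      exact h.agreeOn_sup (hxy a (hs a (Finset.mem_insert_self _ _)))
        (ih fun b hb => hs b (Finset.mem_insert_of_mem hb))
  have hfin : {a : B | IsAtom a}.Finite := Set.toFinite _
  have htop : hfin.toFinset.sup id = ⊤ := by
    by_contra hne
    obtain ⟨a, ha, hle⟩ := (eq_bot_or_exists_atom_le (hfin.toFinset.sup id)ᶜ).resolve_left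
      (by rwa [compl_eq_bot])
    exact ha.1 (le_compl_self.1
      (hle.trans (compl_le_compl (Finset.le_sup (f := id) (hfin.mem_toFinset.2 ha)))))
  have := key hfin.toFinset (fun a ha => hfin.mem_toFinset.1 ha)
  rw [htop] at this
  rw [← h.top x x, this, h.top]

/-- A family indexed by the atoms can be glued. -/
theorem exists_glue [Nonempty A] (h : GuardLaws g) (f : {a : B // IsAtom a} → A) :
    ∃ x, ∀ a, AgreeOn g a.1 x (f a) := by
  classical
  have := Fintype.ofFinite {a : B // IsAtom a}
  suffices ∀ s : Finset {a : B // IsAtom a}, ∃ x, ∀ a ∈ s, AgreeOn g a.1 x (f a) by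
    obtain ⟨x, hx⟩ := this Finset.univ
    exact ⟨x, fun a => hx a (Finset.mem_univ a)⟩
  intro s
  induction s using Finset.induction_on with
  | empty => exact ⟨Classical.arbitrary A, by simp⟩
  | insert b s _ ih =>
    obtain ⟨y, hy⟩ := ih
    -- Overwriting `y` under `b` does not disturb the other atoms, which are disjoint from `b`.
    refine ⟨g b.1 (f b) y, fun a ha => ?_⟩
    by_cases hab : a = b
    · subst hab
      exact h.agreeOn_left le_rfl _ _
    · refine (h.agreeOn_right ?_ _ _).trans (hy a ((Finset.mem_insert.1 ha).resolve_left hab))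
      exact le_compl_iff_disjoint_right.2
        (a.2.disjoint_of_ne b.2 fun e => hab (Subtype.ext e))

end GuardLaws

/-! ## The free Boolean algebra on a finite set -/

namespace BA

variable {T : Type u}

/-- The literals together with `⊥` and `⊤` generate a finite sublattice, by distributivity. Their
set is closed under complement, hence so is the sublattice, which therefore contains the class of
every expression. -/
instance [Finite T] : Finite (BA T) := by
  let s : Set (BA T) := {⊥, ⊤} ∪ (Set.range (fun a => mk (.test a)) ∪
    Set.range fun a => (mk (.test a))ᶜ)
  have hs : s.Finite := (Set.toFinite _).union ((Set.finite_range _).union (Set.finite_range _))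
  have hc : compl '' s = s := by
    simp only [s, Set.image_union, Set.image_pair, compl_bot, compl_top, ← Set.range_comp,
      Function.comp_def, compl_compl]
    rw [Set.pair_comm, Set.union_comm (Set.range _)]
  refine Set.finite_univ_iff.1 (hs.latticeClosure.subset fun b _ => ?_)
  have hL : ∀ c ∈ latticeClosure s, cᶜ ∈ latticeClosure s := fun c hm => by
    rw [← compl_image_latticeClosure_eq_of_compl_image_eq_self hc]
    exact Set.mem_image_of_mem _ hm
  induction b using Quotient.inductionOn with
  | h e =>
    induction e with
    | test a => exact subset_latticeClosure (.inr (.inl ⟨a, rfl⟩))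
    | bot => exact subset_latticeClosure (.inl (.inl rfl))
    | and c d hc hd =>
      exact isSublattice_latticeClosure.infClosed (hc (Set.mem_univ _)) (hd (Set.mem_univ _))
    | not c hc => exact hL _ (hc (Set.mem_univ _))

/-! ### Valuations and nonzero tests -/

/-- The value of a Boolean expression under a valuation. -/
def _root_.BExp.eval (v : T → Bool) : BExp T → Bool
  | .test a => v a
  | .bot => false
  | .and b c => b.eval v && c.eval v
  | .not b => !b.eval v

theorem _root_.BExp.Equiv.eval_eq (v : T → Bool) {b c : BExp T} (h : BExp.Equiv b c) :
    b.eval v = c.eval v := by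
  induction h with
  | refl => rfl
  | symm _ ih => exact ih.symm
  | trans _ _ ih₁ ih₂ => exact ih₁.trans ih₂
  | and_congr _ _ ih₁ ih₂ => simp only [BExp.eval, ih₁, ih₂]
  | not_congr _ ih => simp only [BExp.eval, ih]
  | not_not b => simp [BExp.eval]
  | and_comm b c => exact Bool.and_comm _ _
  | and_assoc b c d => exact Bool.and_assoc _ _ _
  | and_or_self b c => simp only [BExp.eval, BExp.or]; cases b.eval v <;> simp
  | and_or b c d => simp only [BExp.eval, BExp.or]; cases b.eval v <;> simp
  | and_not b => simp [BExp.eval]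

/-- The value of a test under a valuation. -/
def eval (v : T → Bool) : BA T → Bool := Quotient.lift (BExp.eval v) fun _ _ h => h.eval_eq v

theorem ne_bot_of_eval {v : T → Bool} {b : BA T} (h : b.eval v = true) : b ≠ ⊥ := by
  rintro rfl
  exact Bool.noConfusion (h : false = true)

theorem top_ne_bot : (⊤ : BA T) ≠ ⊥ := ne_bot_of_eval (v := fun _ => true) rfl

theorem mk_test_ne_bot (a : T) : mk (.test a) ≠ ⊥ := ne_bot_of_eval (v := fun _ => true) rfl

theorem compl_mk_test_ne_bot (a : T) : (mk (.test a))ᶜ ≠ ⊥ :=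
  ne_bot_of_eval (v := fun _ => false) rfl

end BA

/-! ## Convex algebras and their cones -/

/-- Binary convex combinations satisfying the laws of convex algebra. -/
class BinConvex (A : Type u) where
  comb : unitInterval → A → A → A
  one : ∀ x y, comb 1 x y = x
  idem : ∀ p x, comb p x x = x
  comm : ∀ p x y, comb p x y = comb (unitInterval.symm p) y x
  assoc : ∀ (p q r : unitInterval), (p * q : ℝ) < 1 → (r : ℝ) = q * (1 - p) / (1 - p * q) →
    ∀ x y z, comb q (comb p x y) z = comb (p * q) x (comb r y z)

/-- The cone over `A`: the formal multiples `r • a` with `r > 0`, and `0`. -/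
def Cone (A : Type u) : Type u := Option ({r : ℝ // 0 < r} × A)

namespace Cone

/-- The formal multiple `r • a`, which is `0` unless `r` is positive. -/
noncomputable def pt {A : Type u} (r : ℝ) (a : A) : Cone A :=
  open Classical in if h : 0 < r then some (⟨r, h⟩, a) else none

/-- The ratio `r / (r + s)`. -/
noncomputable def ratio (r s : {r : ℝ // 0 < r}) : unitInterval :=
  ⟨r.1 / (r.1 + s.1), div_nonneg r.2.le (add_pos r.2 s.2).le,
    div_le_one_of_le₀ (le_add_of_nonneg_right s.2.le) (add_pos r.2 s.2).le⟩

variable {A : Type u}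

instance : Zero (Cone A) := ⟨none⟩

theorem pt_of_nonpos {r : ℝ} (h : ¬ 0 < r) (a : A) : pt r a = 0 := dif_neg h

theorem pt_of_pos {r : ℝ} (h : 0 < r) (a : A) : pt r a = some (⟨r, h⟩, a) := dif_pos h

@[simp] theorem pt_zero (a : A) : pt 0 a = 0 := pt_of_nonpos (lt_irrefl 0) a

theorem pt_injective {r : ℝ} (h : 0 < r) : Function.Injective (pt r : A → Cone A) := by
  intro a b e
  rw [pt_of_pos h, pt_of_pos h] at e
  exact congrArg Prod.snd (Option.some_injective _ e)

theorem exists_eq_pt (c : Cone A) : c = 0 ∨ ∃ r a, 0 < r ∧ c = pt r a := by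
  rcases c with _ | ⟨⟨r, hr⟩, a⟩
  · exact .inl rfl
  · exact .inr ⟨r, a, hr, (pt_of_pos hr a).symm⟩

variable [BinConvex A]

/-- Weights add, and points are averaged in proportion to their weights. Positivity of the weights
keeps the side condition of `BinConvex.assoc` satisfied. -/
noncomputable instance : Add (Cone A) where
  add
    | none, d => d
    | some x, none => some x
    | some x, some y =>
      some (⟨x.1.1 + y.1.1, add_pos x.1.2 y.1.2⟩, BinConvex.comb (ratio x.1 y.1) x.2 y.2)

noncomputable instance : AddCommMonoid (Cone A) where
  zero_add _ := rfl
  add_zero := by rintro (_ | _) <;> rfl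
  add_comm := by
    rintro (_ | ⟨⟨r, hr⟩, a⟩) (_ | ⟨⟨s, hs⟩, b⟩)
    · rfl
    · rfl
    · rfl
    · refine congrArg some (Prod.ext (Subtype.ext (add_comm r s)) ?_)
      change BinConvex.comb _ a b = BinConvex.comb _ b a
      rw [BinConvex.comm]
      congr 1
      ext
      have : r + s ≠ 0 := (add_pos hr hs).ne'
      have : s + r ≠ 0 := (add_pos hs hr).ne'
      simp only [ratio, unitInterval.coe_symm_eq]
      field_simp
      ring
  add_assoc := by
    rintro (_ | ⟨⟨r, hr⟩, a⟩) (_ | ⟨⟨s, hs⟩, b⟩) (_ | ⟨⟨t, ht⟩, c⟩)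
    -- These are the cases with a zero summand.
    iterate 7 rfl
    refine congrArg some (Prod.ext (Subtype.ext (add_assoc r s t)) ?_)
    change BinConvex.comb _ (BinConvex.comb _ a b) c = BinConvex.comb _ a (BinConvex.comb _ b c)
    have h₁ : 0 < r + s := add_pos hr hs
    have h₂ : 0 < s + t := add_pos hs ht
    have h₃ : 0 < r + s + t := add_pos h₁ ht
    -- The product of the two nested ratios telescopes to the share of `r` in the total weight.
    have h₄ : r / (r + s) * ((r + s) / (r + s + t)) = r / (r + s + t) := by field_simp
    have h₅ : 1 - r / (r + s + t) = (s + t) / (r + s + t) := by field_simp; ring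
    rw [BinConvex.assoc _ _ (ratio ⟨s, hs⟩ ⟨t, ht⟩)]
    · congr 1
      refine Subtype.ext (h₄.trans ?_)
      change _ = r / (r + (s + t))
      rw [add_assoc]
    · change r / (r + s) * ((r + s) / (r + s + t)) < 1
      rw [h₄, div_lt_one h₃]
      linarith
    · change s / (s + t) = (r + s) / (r + s + t) * (1 - r / (r + s)) /
        (1 - r / (r + s) * ((r + s) / (r + s + t)))
      rw [h₄, h₅]
      field_simp
      ring
  nsmul := nsmulRec

theorem pt_add_pt {r s : ℝ} (hr : 0 < r) (hs : 0 < s) (a b : A) :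
    pt r a + pt s b = pt (r + s) (BinConvex.comb (ratio ⟨r, hr⟩ ⟨s, hs⟩) a b) := by
  rw [pt_of_pos hr, pt_of_pos hs, pt_of_pos (add_pos hr hs)]
  rfl

theorem pt_add {r s : ℝ} (hr : 0 ≤ r) (hs : 0 ≤ s) (a : A) :
    pt (r + s) a = pt r a + pt s a := by
  rcases hr.eq_or_lt with rfl | hr
  · simp
  rcases hs.eq_or_lt with rfl | hs
  · simp
  rw [pt_add_pt hr hs, BinConvex.idem]

theorem zero_comb (a b : A) : BinConvex.comb 0 a b = b := by
  rw [BinConvex.comm, unitInterval.symm_zero, BinConvex.one]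

/-- Together with `pt_injective`, this turns identities between convex combinations into identities
between sums in the cone. The endpoints are separate because `ratio` needs two positive weights. -/
theorem pt_one_comb (p : unitInterval) (a b : A) :
    pt 1 (BinConvex.comb p a b) = pt (p : ℝ) a + pt (1 - p : ℝ) b := by
  rcases p.2.1.eq_or_lt with h | h
  · obtain rfl : p = 0 := Subtype.ext h.symm
    simp [zero_comb]
  rcases p.2.2.eq_or_lt with k | k
  · obtain rfl : p = 1 := Subtype.ext k
    simp [BinConvex.one]
  rw [pt_add_pt h (sub_pos.2 k), add_sub_cancel]
  congr 2
  ext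
  simp [ratio]

/-- The additive map determined by additive maps on the rays. -/
def lift {M : Type v} [AddCommMonoid M] (F : ℝ → A → M)
    (hF : ∀ (r s : {r : ℝ // 0 < r}) (a b : A),
      F (r + s) (BinConvex.comb (ratio r s) a b) = F r a + F s b) : Cone A →+ M where
  toFun
    | none => 0
    | some x => F x.1 x.2
  map_zero' := rfl
  map_add' := by
    rintro (_ | x) (_ | y)
    · exact (add_zero _).symm
    · exact (zero_add _).symm
    · exact (add_zero _).symm
    · exact hF x.1 y.1 x.2 y.2

theorem lift_pt {M : Type v} [AddCommMonoid M] (F : ℝ → A → M) (hF) {r : ℝ} (h : 0 < r) (a : A) :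
    lift F hF (pt r a) = F r a := by
  rw [pt_of_pos h]
  rfl

/-- The total weight of an element of the cone. -/
def weight : Cone A →+ ℝ := lift (fun r _ => r) fun _ _ _ _ => rfl

theorem weight_pt {r : ℝ} (h : 0 ≤ r) (a : A) : weight (pt r a) = r := by
  rcases h.eq_or_lt with rfl | h
  · simp
  · exact lift_pt _ _ h a

theorem exists_pt_one {c : Cone A} (h : weight c = 1) : ∃ a, pt 1 a = c := by
  rcases exists_eq_pt c with rfl | ⟨r, a, hr, rfl⟩
  · simp at h
  · rw [weight_pt hr.le] at h
    exact ⟨a, by rw [h]⟩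

/-- Multiplication by a nonnegative scalar. -/
noncomputable def scale (p : ℝ) (hp : 0 ≤ p) : Cone A →+ Cone A :=
  lift (fun r a => pt (p * r) a) fun r s a b => by
    rcases hp.eq_or_lt with rfl | hp
    · simp
    · rw [pt_add_pt (mul_pos hp r.2) (mul_pos hp s.2), mul_add]
      congr 2
      ext
      simp only [ratio]
      rw [← mul_add, mul_div_mul_left _ _ hp.ne']

theorem scale_pt {p r : ℝ} (hp : 0 ≤ p) (hr : 0 ≤ r) (a : A) :
    scale p hp (pt r a) = pt (p * r) a := by
  rcases hr.eq_or_lt with rfl | hr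
  · simp
  · exact lift_pt _ _ hr a

/-- The action of the cone on maps that preserve convex combinations. -/
noncomputable def map {B : Type v} [BinConvex B] (f : A → B)
    (hf : ∀ p a b, f (BinConvex.comb p a b) = BinConvex.comb p (f a) (f b)) :
    Cone A →+ Cone B :=
  lift (fun r a => pt r (f a)) fun r s a b => by rw [hf, pt_add_pt r.2 s.2]

theorem map_pt {B : Type v} [BinConvex B] (f : A → B) (hf) {r : ℝ} (hr : 0 ≤ r) (a : A) :
    map f hf (pt r a) = pt r (f a) := by
  rcases hr.eq_or_lt with rfl | hr
  · simp
  · exact lift_pt _ _ hr a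

end Cone

/-! ## Barycentres -/

namespace SubDist

variable {X : Type u}

@[simp] theorem weights_mix (p : unitInterval) (θ ψ : SubDist X) :
    (mix p θ ψ).weights = (p : ℝ) • θ.weights + (1 - p : ℝ) • ψ.weights :=
  Convexity.StdSimplex.weights_convexCombPair _ _ _ _ _ _ _

theorem weights_mix_apply (p : unitInterval) (θ ψ : SubDist X) (o : Option X) :
    (mix p θ ψ).weights o = p * θ.weights o + (1 - p) * ψ.weights o := by
  simp

theorem ext_weights {θ ψ : SubDist X} (h : ∀ o, θ.weights o = ψ.weights o) : θ = ψ :=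
  Convexity.StdSimplex.ext (Finsupp.ext h)

noncomputable instance : BinConvex (SubDist X) where
  comb := mix
  one θ ψ := ext_weights fun o => by rw [weights_mix_apply]; simp
  idem p θ := ext_weights fun o => by rw [weights_mix_apply]; ring
  comm p θ ψ := ext_weights fun o => by
    rw [weights_mix_apply, weights_mix_apply, unitInterval.coe_symm_eq]; ring
  assoc p q r hpq hr θ ψ φ := ext_weights fun o => by
    have h : (r : ℝ) * (1 - p * q) = q * (1 - p) := by
      rw [hr, div_mul_cancel₀ _ (sub_pos.2 hpq).ne']
    simp only [weights_mix_apply, Set.Icc.coe_mul]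
    linear_combination (φ.weights o - ψ.weights o) * h

theorem sum_weights_eq_one (θ : SubDist X) {s : Finset (Option X)} (hs : θ.weights.support ⊆ s) :
    ∑ o ∈ s, θ.weights o = 1 := by
  rw [← θ.total, Finsupp.sum_of_support_subset _ hs _ fun _ _ => rfl]

section Barycentre

variable {A : Type v} [BinConvex A]

/-- The sum has weight `∑ θ(o) = 1`, and the elements of weight one in the cone are the points of
`A`. -/
theorem exists_barycentre (f : Option X → A) (θ : SubDist X) :
    ∃ a, Cone.pt 1 a = ∑ o ∈ θ.weights.support, Cone.pt (θ.weights o) (f o) := by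
  refine Cone.exists_pt_one ?_
  rw [map_sum, Finset.sum_congr rfl fun o _ => Cone.weight_pt (θ.weights_nonneg o) (f o)]
  exact θ.sum_weights_eq_one subset_rfl

/-- The barycentre of the points `f o` with respect to `θ`. -/
noncomputable def barycentre (f : Option X → A) (θ : SubDist X) : A :=
  (exists_barycentre f θ).choose

/-- The freedom in `s` allows two distributions to be summed over a common index set. -/
theorem pt_barycentre (f : Option X → A) (θ : SubDist X) {s : Finset (Option X)}
    (hs : θ.weights.support ⊆ s) :
    Cone.pt 1 (barycentre f θ) = ∑ o ∈ s, Cone.pt (θ.weights o) (f o) := by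
  rw [barycentre, (exists_barycentre f θ).choose_spec]
  refine Finset.sum_subset hs fun o _ ho => ?_
  rw [Finsupp.notMem_support_iff.1 ho, Cone.pt_zero]

theorem barycentre_single (f : Option X → A) (o : Option X) :
    barycentre f (.single o) = f o := by
  apply Cone.pt_injective one_pos
  rw [pt_barycentre f _ (s := {o}) Finsupp.support_single_subset]
  simp

theorem barycentre_mix (f : Option X → A) (p : unitInterval) (θ ψ : SubDist X) :
    barycentre f (mix p θ ψ) = BinConvex.comb p (barycentre f θ) (barycentre f ψ) := by
  classical
  apply Cone.pt_injective one_pos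
  have hp : (0 : ℝ) ≤ p := p.2.1
  have hp' : (0 : ℝ) ≤ 1 - p := sub_nonneg.2 p.2.2
  have scale_barycentre : ∀ {r : ℝ} (hr : 0 ≤ r) (φ : SubDist X) {s : Finset (Option X)},
      φ.weights.support ⊆ s →
        Cone.pt r (barycentre f φ) = ∑ o ∈ s, Cone.pt (r * φ.weights o) (f o) := by
    intro r hr φ s hs
    rw [← mul_one r, ← Cone.scale_pt hr zero_le_one, pt_barycentre f φ hs, map_sum, mul_one]
    exact Finset.sum_congr rfl fun o _ => Cone.scale_pt hr (φ.weights_nonneg o) _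
  let s := θ.weights.support ∪ ψ.weights.support
  rw [Cone.pt_one_comb, scale_barycentre hp θ (s := s) Finset.subset_union_left,
    scale_barycentre hp' ψ (s := s) Finset.subset_union_right, ← Finset.sum_add_distrib,
    pt_barycentre f _ (s := s)]
  · refine Finset.sum_congr rfl fun o _ => ?_
    rw [weights_mix_apply, Cone.pt_add (mul_nonneg hp (θ.weights_nonneg o))
      (mul_nonneg hp' (ψ.weights_nonneg o))]
  · rw [weights_mix]
    exact Finsupp.support_add.trans
      (Finset.union_subset_union Finsupp.support_smul Finsupp.support_smul)

/-! ### Uniqueness of convex maps on the simplex -/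

/-- The cone over the simplex embeds into the space of finitely supported functions. -/
noncomputable def coneToFinsupp (X : Type u) : Cone (SubDist X) →+ (Option X →₀ ℝ) :=
  Cone.lift (fun r θ => r • θ.weights) fun r s θ ψ => by
    change _ • (mix _ θ ψ).weights = _
    have : (r : ℝ) + s ≠ 0 := (add_pos r.2 s.2).ne'
    ext o
    rw [Finsupp.smul_apply, weights_mix_apply]
    simp only [Cone.ratio, Finsupp.add_apply, Finsupp.smul_apply, smul_eq_mul]
    field_simp
    ring

theorem coneToFinsupp_pt {r : ℝ} (hr : 0 ≤ r) (θ : SubDist X) :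
    coneToFinsupp X (Cone.pt r θ) = r • θ.weights := by
  rcases hr.eq_or_lt with rfl | hr
  · simp
  · exact Cone.lift_pt _ _ hr θ

theorem sum_smul_weights (r : ℝ) (θ : SubDist X) :
    (r • θ.weights).sum (fun _ s => s) = r := by
  rw [Finsupp.sum_smul_index fun _ => rfl, ← Finsupp.mul_sum, θ.total, mul_one]

/-- The scalar `r` is recovered as the total of `r • θ`; cancelling it recovers `θ`. -/
theorem coneToFinsupp_injective : Function.Injective (coneToFinsupp X) := by
  intro c d h
  rcases Cone.exists_eq_pt c with rfl | ⟨r, θ, hr, rfl⟩ <;>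
    rcases Cone.exists_eq_pt d with rfl | ⟨s, ψ, hs, rfl⟩
  · rfl
  · rw [map_zero, coneToFinsupp_pt hs.le] at h
    have := sum_smul_weights s ψ
    rw [← h, Finsupp.sum_zero_index] at this
    exact absurd this hs.ne
  · rw [map_zero, coneToFinsupp_pt hr.le] at h
    have := sum_smul_weights r θ
    rw [h, Finsupp.sum_zero_index] at this
    exact absurd this hr.ne
  · rw [coneToFinsupp_pt hs.le, coneToFinsupp_pt hr.le] at h
    obtain rfl : r = s := by rw [← sum_smul_weights r θ, h, sum_smul_weights]
    rw [Convexity.StdSimplex.ext (smul_right_injective _ hr.ne' h)]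

theorem pt_one_eq_sum (θ : SubDist X) :
    Cone.pt 1 θ = ∑ o ∈ θ.weights.support,
      Cone.pt (θ.weights o) (Convexity.StdSimplex.single o : SubDist X) := by
  apply coneToFinsupp_injective
  rw [map_sum, coneToFinsupp_pt zero_le_one,
    Finset.sum_congr rfl fun o _ => coneToFinsupp_pt (θ.weights_nonneg o) _, one_smul]
  simp only [Convexity.StdSimplex.weights_single, Finsupp.smul_single, smul_eq_mul, mul_one]
  exact (Finsupp.sum_single _).symm

/-- A map that preserves convex combinations is determined by its values on point masses. -/
theorem eq_barycentre {h : SubDist X → A}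
    (hh : ∀ p θ ψ, h (mix p θ ψ) = BinConvex.comb p (h θ) (h ψ)) (θ : SubDist X) :
    h θ = barycentre (fun o => h (.single o)) θ := by
  apply Cone.pt_injective one_pos
  rw [pt_barycentre _ θ subset_rfl, ← Cone.map_pt h hh zero_le_one, pt_one_eq_sum, map_sum]
  exact Finset.sum_congr rfl fun o _ => Cone.map_pt h hh (θ.weights_nonneg o) _

end Barycentre

end SubDist

/-! ## Terms, derivability and homomorphisms -/

namespace Sig

variable {S : Sig.{u}} {X Y : Type*} {A B : Type*}

theorem Alg.eval_subst (ρ : S.Alg A) (e : Y → A) (ν : X → S.Term Y) (t : S.Term X) :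
    ρ.eval e (t.subst ν) = ρ.eval (fun x => ρ.eval e (ν x)) t := by
  induction t with
  | var x => rfl
  | op σ args ih => exact congrArg (ρ σ) (funext ih)

theorem Alg.eval_rename (ρ : S.Alg A) (e : Y → A) (f : X → Y) (t : S.Term X) :
    ρ.eval e (t.rename f) = ρ.eval (fun x => e (f x)) t :=
  ρ.eval_subst e _ t

theorem IsHom.map_eval {ρ : S.Alg A} {μ : S.Alg B} {h : A → B} (hh : IsHom ρ μ h) (e : X → A)
    (t : S.Term X) : h (ρ.eval e t) = μ.eval (fun x => h (e x)) t := by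
  induction t with
  | var x => rfl
  | op σ args ih => exact (hh σ _).trans (congrArg (μ σ) (funext ih))

/-- Equational logic is sound. -/
theorem Eqns.Derives.eval_eq {E : S.Eqns} {t s : S.Term X} (h : E.Derives t s) {ρ : S.Alg A}
    (hρ : ρ.Satisfies E) (e : X → A) : ρ.eval e t = ρ.eval e s := by
  induction h with
  | ax hE ν => rw [Alg.eval_subst, Alg.eval_subst, hρ _ _ hE]
  | refl t => rfl
  | symm _ ih => exact ih.symm
  | trans _ _ ih₁ ih₂ => exact ih₁.trans ih₂
  | congr σ _ ih => exact congrArg (ρ σ) (funext ih)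

namespace Eqns

/-- Derivable equality as a setoid. -/
def derivesSetoid (E : S.Eqns) (X : Type v) : Setoid (S.Term X) :=
  ⟨E.Derives, .refl, .symm, .trans⟩

/-- Terms modulo derivable equality. -/
def TermQuotient (E : S.Eqns) (X : Type v) : Type (max u v) := Quotient (E.derivesSetoid X)

namespace TermQuotient

variable (E : S.Eqns) (X : Type v)

/-- The class of a term. -/
def mk {E : S.Eqns} {X : Type v} (t : S.Term X) : E.TermQuotient X := Quotient.mk _ t

/-- The algebra of terms modulo derivable equality. -/
noncomputable def alg : S.Alg (E.TermQuotient X) :=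
  fun σ a => mk (.op σ fun i => Quotient.out (a i))

variable {E X}

theorem mk_eq {t s : S.Term X} : (mk t : E.TermQuotient X) = mk s ↔ E.Derives t s :=
  Quotient.eq (r := E.derivesSetoid X)

theorem mk_op (σ : S.Op) (args : Fin (S.ar σ) → S.Term X) :
    (mk (.op σ args) : E.TermQuotient X) = alg E X σ fun i => mk (args i) :=
  mk_eq.2 (.congr σ fun i => (Quotient.mk_out (s := E.derivesSetoid X) (args i)).symm)

theorem eval_mk (ν : Y → S.Term X) (t : S.Term Y) :
    (alg E X).eval (fun y => mk (ν y)) t = mk (t.subst ν) := by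
  induction t with
  | var x => rfl
  | op σ args ih => exact (congrArg (alg E X σ) (funext ih)).trans (mk_op _ _).symm

theorem eval_var (t : S.Term X) : (alg E X).eval (fun x => mk (.var x)) t = mk t := by
  induction t with
  | var x => rfl
  | op σ args ih => exact (congrArg (alg E X σ) (funext ih)).trans (mk_op _ _).symm

/-- Choosing representatives turns an assignment into a substitution, and axioms may be used under
any substitution. -/
theorem satisfies : (alg E X).Satisfies E := fun l r h e => by
  have he : e = fun n => mk (Quotient.out (e n)) := funext fun n => (Quotient.out_eq _).symm
  rw [he, eval_mk, eval_mk]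
  exact mk_eq.2 (.ax h _)

end TermQuotient

end Eqns

end Sig

/-! ## Models of guarded convex algebra -/

namespace GC

open Sig

variable {T : Type u} {A : Type v}

/-- The operation `+_b` of an algebra. -/
def guardOp (μ : (GCSig T).Alg A) (b : BA T) (x y : A) : A := μ (.guard b) ![x, y]

/-- The operation `⊕_p` of an algebra. -/
def convOp (μ : (GCSig T).Alg A) (p : unitInterval) (x y : A) : A := μ (.conv p) ![x, y]

/-- The constant `0` of an algebra. -/
def zeroOp (μ : (GCSig T).Alg A) : A := μ .zero Fin.elim0

theorem alg_zero (μ : (GCSig T).Alg A) (a : Fin 0 → A) : μ GCOp.zero a = zeroOp μ :=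
  congrArg (μ GCOp.zero) (Subsingleton.elim (α := Fin 0 → A) _ _)

theorem alg_guard (μ : (GCSig T).Alg A) (b : BA T) (a : Fin 2 → A) :
    μ (GCOp.guard b) a = guardOp μ b (a 0) (a 1) :=
  congrArg (μ (GCOp.guard b)) (List.ofFn_injective rfl : a = ![a 0, a 1])

theorem alg_conv (μ : (GCSig T).Alg A) (p : unitInterval) (a : Fin 2 → A) :
    μ (GCOp.conv p) a = convOp μ p (a 0) (a 1) :=
  congrArg (μ (GCOp.conv p)) (List.ofFn_injective rfl : a = ![a 0, a 1])

theorem isHom_iff {B : Type w} {ρ : (GCSig T).Alg A} {μ : (GCSig T).Alg B} {h : A → B} :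
    IsHom ρ μ h ↔ h (zeroOp ρ) = zeroOp μ ∧
      (∀ b x y, h (guardOp ρ b x y) = guardOp μ b (h x) (h y)) ∧
      ∀ p x y, h (convOp ρ p x y) = convOp μ p (h x) (h y) := by
  constructor
  · intro hh
    refine ⟨(hh .zero _).trans (alg_zero _ _), fun b x y => (hh (.guard b) _).trans ?_,
      fun p x y => (hh (.conv p) _).trans ?_⟩
    · exact alg_guard μ b _
    · exact alg_conv μ p _
  · rintro ⟨h₀, hg, hc⟩ (_ | b | p) a
    · exact (congrArg h (alg_zero ρ a)).trans (h₀.trans (alg_zero μ _).symm)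
    · exact (congrArg h (alg_guard ρ b a)).trans
        ((hg b _ _).trans (alg_guard μ b fun i : Fin 2 => h (a i)).symm)
    · exact (congrArg h (alg_conv ρ p a)).trans
        ((hc p _ _).trans (alg_conv μ p fun i : Fin 2 => h (a i)).symm)

section Eval

variable {X : Type w} (μ : (GCSig T).Alg A) (e : X → A)

@[simp] theorem eval_guard (b : BA T) (t s : (GCSig T).Term X) :
    μ.eval e (guard b t s) = guardOp μ b (μ.eval e t) (μ.eval e s) := alg_guard μ b _

@[simp] theorem eval_conv (p : unitInterval) (t s : (GCSig T).Term X) :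
    μ.eval e (conv p t s) = convOp μ p (μ.eval e t) (μ.eval e s) := alg_conv μ p _

@[simp] theorem eval_var (x : X) : μ.eval e (.var x) = e x := rfl

end Eval

/-- The laws of guarded convex algebra, for the operations of an algebra. -/
structure Laws (μ : (GCSig T).Alg A) : Prop where
  guard : GuardLaws (guardOp μ)
  one : ∀ x y, convOp μ 1 x y = x
  idem : ∀ p x, convOp μ p x x = x
  comm : ∀ p x y, convOp μ p x y = convOp μ (unitInterval.symm p) y x
  assoc : ∀ (p q r : unitInterval), (p * q : ℝ) < 1 → (r : ℝ) = q * (1 - p) / (1 - p * q) →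
    ∀ x y z, convOp μ q (convOp μ p x y) z = convOp μ (p * q) x (convOp μ r y z)
  dist : ∀ p b x y z,
    convOp μ p x (guardOp μ b y z) = guardOp μ b (convOp μ p x y) (convOp μ p x z)

theorem satisfies_iff {μ : (GCSig T).Alg A} : μ.Satisfies (GC T) ↔ Laws μ := by
  constructor
  · intro h
    have key : ∀ x y z : A, ∃ e : ℕ → A, e 0 = x ∧ e 1 = y ∧ e 2 = z := fun x y z =>
      ⟨fun n => if n = 0 then x else if n = 1 then y else z, by simp⟩
    refine ⟨⟨fun x y => ?_, fun b x => ?_, fun b x y => ?_, fun b c x y z => ?_⟩,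
      fun x y => ?_, fun p x => ?_, fun p x y => ?_, fun p q r hpq hr x y z => ?_,
      fun p b x y z => ?_⟩
    · obtain ⟨e, rfl, rfl, -⟩ := key x y x
      simpa using h _ _ (.inl .top) e
    · obtain ⟨e, rfl, -⟩ := key x x x
      simpa using h _ _ (.inl (.idem b)) e
    · obtain ⟨e, rfl, rfl, -⟩ := key x y x
      simpa using h _ _ (.inl (.comm b)) e
    · obtain ⟨e, rfl, rfl, rfl⟩ := key x y z
      simpa using h _ _ (.inl (.assoc b c)) e
    · obtain ⟨e, rfl, rfl, -⟩ := key x y x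
      simpa using h _ _ (.inr (.inl .one)) e
    · obtain ⟨e, rfl, -⟩ := key x x x
      simpa using h _ _ (.inr (.inl (.idem p))) e
    · obtain ⟨e, rfl, rfl, -⟩ := key x y x
      simpa using h _ _ (.inr (.inl (.comm p))) e
    · obtain ⟨e, rfl, rfl, rfl⟩ := key x y z
      simpa using h _ _ (.inr (.inl (.assoc p q r hpq hr))) e
    · obtain ⟨e, rfl, rfl, rfl⟩ := key x y z
      simpa using h _ _ (.inr (.inr (.dist p b))) e
  · rintro h l r (hE | hE | hE) e <;> cases hE <;> simp only [eval_guard, eval_conv, eval_var]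
    · exact h.guard.top _ _
    · exact h.guard.idem _ _
    · exact h.guard.comm _ _ _
    · exact h.guard.assoc _ _ _ _ _
    · exact h.one _ _
    · exact h.idem _ _
    · exact h.comm _ _ _
    · exact h.assoc _ _ _ ‹_› ‹_› _ _ _
    · exact h.dist _ _ _ _ _

namespace Laws

variable {μ : (GCSig T).Alg A}

/-- The convex algebra underlying a guarded convex algebra. -/
abbrev binConvex (h : Laws μ) : BinConvex A :=
  ⟨convOp μ, h.one, h.idem, h.comm, h.assoc⟩

/-- This is where the distribution law enters. With else-branch `x ⊕_p y`, both sides of the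
required equation have the form `x ⊕_p (- +_b y)`. -/
theorem agreeOn_conv_right (h : Laws μ) (p : unitInterval) {b : BA T} (x : A) {y y' : A}
    (hy : AgreeOn (guardOp μ) b y y') :
    AgreeOn (guardOp μ) b (convOp μ p x y) (convOp μ p x y') :=
  h.guard.agreeOn_of_eq (c := convOp μ p x y) (by rw [← h.dist, ← h.dist, hy])

theorem agreeOn_conv (h : Laws μ) (p : unitInterval) {b : BA T} {x x' y y' : A}
    (hx : AgreeOn (guardOp μ) b x x') (hy : AgreeOn (guardOp μ) b y y') :
    AgreeOn (guardOp μ) b (convOp μ p x y) (convOp μ p x' y') := by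
  refine (h.agreeOn_conv_right p x hy).trans ?_
  rw [h.comm, h.comm p x']
  exact h.agreeOn_conv_right _ _ hx

end Laws

/-- An else-branch in the image of `h` lets the equation be pulled back along `h`; one such branch
is enough. -/
theorem agreeOn_map {B : Type w} {ρ : (GCSig T).Alg A} {μ : (GCSig T).Alg B} {h : A → B}
    (hh : IsHom ρ μ h) (hμ : Laws μ) {b : BA T} {x y : A} (hxy : AgreeOn (guardOp ρ) b x y) :
    AgreeOn (guardOp μ) b (h x) (h y) :=
  hμ.guard.agreeOn_of_eq (c := h x) (by
    rw [← (isHom_iff.1 hh).2.1, ← (isHom_iff.1 hh).2.1, hxy])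

end GC

/-! ## The universal property of `𝒟 (⊥ + X) ^ At` -/

namespace GCFree

open Sig GC

variable {T : Type u} {X : Type v}

theorem zeroOp_apply (α : At T) : zeroOp (alg T X) α = SubDist.diracBot := rfl

open Classical in
theorem guardOp_apply (b : BA T) (χ ψ : GCFree T X) (α : At T) :
    guardOp (alg T X) b χ ψ α = if α.1 ≤ b then χ α else ψ α := rfl

theorem convOp_apply (p : unitInterval) (χ ψ : GCFree T X) (α : At T) :
    convOp (alg T X) p χ ψ α = SubDist.mix p (χ α) (ψ α) := rfl

theorem laws (T : Type u) (X : Type v) : Laws (alg T X) where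
  guard.top χ ψ := funext fun α => if_pos le_top
  guard.idem b χ := funext fun α => ite_self _
  guard.comm b χ ψ := funext fun α => by
    have : α.1 ≤ bᶜ ↔ ¬ α.1 ≤ b := by
      rw [le_compl_iff_disjoint_right, α.2.not_le_iff_disjoint]
    by_cases h : α.1 ≤ b <;> simp [guardOp_apply, this, h]
  guard.assoc b c χ ψ φ := funext fun α => by
    by_cases h : α.1 ≤ b <;> by_cases k : α.1 ≤ c <;> simp [guardOp_apply, h, k]
  one χ ψ := funext fun α => BinConvex.one (χ α) (ψ α)
  idem p χ := funext fun α => BinConvex.idem p (χ α)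
  comm p χ ψ := funext fun α => BinConvex.comm p (χ α) (ψ α)
  assoc p q r hpq hr χ ψ φ := funext fun α => BinConvex.assoc p q r hpq hr (χ α) (ψ α) (φ α)
  dist p b χ ψ φ := funext fun α => by
    by_cases h : α.1 ≤ b <;> simp [guardOp_apply, convOp_apply, h]

theorem agreeOn_of_apply_eq {χ ψ : GCFree T X} {α : At T} (h : χ α = ψ α) :
    AgreeOn (guardOp (alg T X)) α.1 χ ψ := fun φ => funext fun β => by
  by_cases hβ : β.1 ≤ α.1
  · obtain rfl : β = α := Subtype.ext ((α.2.le_iff.1 hβ).resolve_left β.2.1)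
    simp [guardOp_apply, h]
  · simp [guardOp_apply, hβ]

section Extension

variable {A : Type w} {μ : (GCSig T).Alg A}

/-- The value of the extension of `f` at a subdistribution. -/
noncomputable def extendConst (hμ : Laws μ) (f : X → A) (θ : SubDist X) : A :=
  letI := hμ.binConvex
  SubDist.barycentre (fun o => o.elim (zeroOp μ) f) θ

theorem extendConst_diracBot (hμ : Laws μ) (f : X → A) :
    extendConst hμ f SubDist.diracBot = zeroOp μ :=
  letI := hμ.binConvex
  SubDist.barycentre_single _ _

theorem extendConst_dirac (hμ : Laws μ) (f : X → A) (x : X) :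
    extendConst hμ f (SubDist.dirac x) = f x :=
  letI := hμ.binConvex
  SubDist.barycentre_single _ _

theorem extendConst_mix (hμ : Laws μ) (f : X → A) (p : unitInterval) (θ ψ : SubDist X) :
    extendConst hμ f (SubDist.mix p θ ψ) =
      convOp μ p (extendConst hμ f θ) (extendConst hμ f ψ) :=
  letI := hμ.binConvex
  SubDist.barycentre_mix _ _ _ _

/-- On constant families `h` preserves convex combinations, so it is the barycentre map of its
values at point masses. -/
theorem apply_const (hμ : Laws μ) {h : GCFree T X → A} (hh : IsHom (alg T X) μ h)
    (θ : SubDist X) : h (fun _ => θ) = extendConst hμ (fun x => h (unit x)) θ := by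
  let _ := hμ.binConvex
  refine (SubDist.eq_barycentre (h := fun θ => h fun _ => θ)
    (fun p θ ψ => (isHom_iff.1 hh).2.2 p _ _) θ).trans ?_
  unfold extendConst
  congr 1
  funext o
  cases o with
  | none => exact (isHom_iff.1 hh).1
  | some x => rfl

variable [Finite T]

theorem exists_extend (hμ : Laws μ) (f : X → A) (χ : GCFree T X) :
    ∃ a, ∀ α : At T, AgreeOn (guardOp μ) α.1 a (extendConst hμ f (χ α)) :=
  haveI : Nonempty A := ⟨zeroOp μ⟩
  hμ.guard.exists_glue _

/-- The extension of `f` to a homomorphism. -/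
noncomputable def extend (hμ : Laws μ) (f : X → A) (χ : GCFree T X) : A :=
  (exists_extend hμ f χ).choose

theorem agreeOn_extend (hμ : Laws μ) (f : X → A) (χ : GCFree T X) (α : At T) :
    AgreeOn (guardOp μ) α.1 (extend hμ f χ) (extendConst hμ f (χ α)) :=
  (exists_extend hμ f χ).choose_spec α

/-- The glued element is defined by choice; this characterization is what makes it usable. -/
theorem extend_eq (hμ : Laws μ) {f : X → A} {χ : GCFree T X} {a : A}
    (h : ∀ α : At T, AgreeOn (guardOp μ) α.1 (extendConst hμ f (χ α)) a) :
    extend hμ f χ = a :=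
  hμ.guard.ext_atoms fun α hα => (agreeOn_extend hμ f χ ⟨α, hα⟩).trans (h ⟨α, hα⟩)

theorem extend_unit (hμ : Laws μ) (f : X → A) (x : X) :
    extend hμ f (unit x : GCFree T X) = f x :=
  extend_eq hμ fun α => by
    rw [unit, extendConst_dirac]
    exact .refl _

theorem isHom_extend (hμ : Laws μ) (f : X → A) : IsHom (alg T X) μ (extend hμ f) := by
  refine isHom_iff.2 ⟨extend_eq hμ fun α => ?_, fun b χ ψ => extend_eq hμ fun α => ?_,
    fun p χ ψ => extend_eq hμ fun α => ?_⟩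
  · rw [zeroOp_apply, extendConst_diracBot]
    exact .refl _
  · refine .trans ?_ (hμ.guard.agreeOn_guard α.2 b (agreeOn_extend hμ f χ α)
      (agreeOn_extend hμ f ψ α)).symm
    rw [guardOp_apply]
    by_cases h : α.1 ≤ b
    · rw [if_pos h]
      exact (hμ.guard.agreeOn_left h _ _).symm
    · rw [if_neg h]
      exact (hμ.guard.agreeOn_right
        (le_compl_iff_disjoint_right.2 (α.2.not_le_iff_disjoint.1 h)) _ _).symm
  · rw [convOp_apply, extendConst_mix]
    exact (hμ.agreeOn_conv p (agreeOn_extend hμ f χ α) (agreeOn_extend hμ f ψ α)).symm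

/-- Under `α`, the family `χ` agrees with the constant family at `χ α`, and homomorphisms preserve
agreement. -/
theorem eq_extend (hμ : Laws μ) {h : GCFree T X → A} (hh : IsHom (alg T X) μ h)
    (χ : GCFree T X) : h χ = extend hμ (fun x => h (unit x)) χ :=
  (extend_eq hμ fun α => by
    rw [← apply_const hμ hh]
    exact agreeOn_map hh hμ (agreeOn_of_apply_eq rfl)).symm

theorem hom_ext (hμ : Laws μ) {h k : GCFree T X → A} (hh : IsHom (alg T X) μ h)
    (hk : IsHom (alg T X) μ k) (hhk : ∀ x, h (unit x) = k (unit x)) : h = k :=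
  funext fun χ => by rw [eq_extend hμ hh, eq_extend hμ hk, funext hhk]

end Extension

/-! ## Completeness -/

section Complete

variable [Finite T]

theorem termQuotient_laws (T : Type u) (X : Type v) :
    Laws (Eqns.TermQuotient.alg (GC T) X) :=
  satisfies_iff.1 Eqns.TermQuotient.satisfies

/-- The homomorphism from the free algebra to terms modulo derivable equality. -/
noncomputable def toTerm (χ : GCFree T X) : (GC T).TermQuotient X :=
  extend (termQuotient_laws T X) (fun x => .mk (.var x)) χ

theorem toTerm_eval (t : (GCSig T).Term X) : toTerm ((alg T X).eval unit t) = .mk t := by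
  refine ((isHom_extend (termQuotient_laws T X) _).map_eval unit t).trans ?_
  simp only [extend_unit]
  exact Eqns.TermQuotient.eval_var t

/-- Equality in the free algebra is derivable. -/
theorem derives_of_eval_eq {t s : (GCSig T).Term X}
    (h : (alg T X).eval unit t = (alg T X).eval unit s) : (GC T).Derives t s :=
  Eqns.TermQuotient.mk_eq.1 (by rw [← toTerm_eval, h, toTerm_eval])

/-- Every element of the free algebra is the value of a term. -/
theorem exists_eval_eq (χ : GCFree T X) : ∃ t, (alg T X).eval unit t = χ := by
  let ev : (GC T).TermQuotient X → GCFree T X := Quotient.lift ((alg T X).eval unit)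
    fun _ _ h => Eqns.Derives.eval_eq h (satisfies_iff.2 (laws T X)) unit
  have hev : IsHom (Eqns.TermQuotient.alg (GC T) X) (alg T X) ev := fun σ a =>
    congrArg (alg T X σ) (funext fun i => by
      conv_rhs => rw [← Quotient.out_eq (a i)]
      rfl)
  have hcomp : IsHom (alg T X) (alg T X) fun χ => ev (toTerm χ) := fun σ a =>
    (congrArg ev (isHom_extend (termQuotient_laws T X) _ σ a)).trans (hev σ _)
  -- Passing to terms and evaluating back is an endomorphism fixing the generators, hence the
  -- identity.
  have key := hom_ext (laws T X) hcomp (k := id) (fun _ _ => rfl) fun x =>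
    congrArg ev (extend_unit (termQuotient_laws T X) _ x)
  exact ⟨Quotient.out (toTerm χ),
    (congrArg ev (Quotient.out_eq (toTerm χ))).trans (congrFun key χ)⟩

end Complete

end GCFree

/-! ## Functoriality -/

namespace SubDist

variable {X : Type v} {Y : Type w}

theorem map_mix (f : X → Y) (p : unitInterval) (θ ψ : SubDist X) :
    (mix p θ ψ).map (Option.map f) =
      mix p (θ.map (Option.map f)) (ψ.map (Option.map f)) :=
  (Convexity.StdSimplex.isAffineMap_map ℝ (Option.map f)).map_convexCombPair _ _ _ θ ψ

/-- Nonnegative weights cannot cancel in a pushforward. This gives naturality of the support. -/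
theorem weights_map_pos_iff (f : X → Y) (θ : SubDist X) (y : Y) :
    0 < (θ.map (Option.map f)).weights (some y) ↔ ∃ x, 0 < θ.weights (some x) ∧ f x = y := by
  classical
  rw [Convexity.StdSimplex.weights_map, Finsupp.mapDomain, Finsupp.sum_apply, Finsupp.sum]
  simp only [Finsupp.single_apply]
  have hnn : ∀ o ∈ θ.weights.support,
      0 ≤ if Option.map f o = some y then θ.weights o else 0 := fun o _ => by
    split_ifs
    exacts [θ.weights_nonneg o, le_rfl]
  rw [lt_iff_le_and_ne, and_iff_right (Finset.sum_nonneg hnn), ne_comm, Ne,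
    Finset.sum_eq_zero_iff_of_nonneg hnn]
  push Not
  constructor
  · rintro ⟨o, -, ho⟩
    obtain ⟨h, h'⟩ := ite_ne_right_iff.1 ho
    obtain ⟨x, rfl, rfl⟩ := Option.map_eq_some_iff.1 h
    exact ⟨x, (θ.weights_nonneg _).lt_of_ne' h', rfl⟩
  · rintro ⟨x, hx, rfl⟩
    exact ⟨some x, Finsupp.mem_support_iff.2 hx.ne', by simpa using hx.ne'⟩

end SubDist

namespace GCFree

open Sig GC

variable {T : Type u} {X : Type v} {Y : Type w}

/-- The action of the free algebra construction on functions. -/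
noncomputable def map (f : X → Y) (χ : GCFree T X) : GCFree T Y :=
  fun α => (χ α).map (Option.map f)

theorem map_unit (f : X → Y) (x : X) : map f (unit x : GCFree T X) = unit (f x) :=
  funext fun _ => Convexity.StdSimplex.map_single _ _

theorem isHom_map (f : X → Y) : IsHom (alg T X) (alg T Y) (map f) := by
  refine isHom_iff.2 ⟨?_, fun b χ ψ => ?_, fun p χ ψ => ?_⟩
  · exact funext fun _ => Convexity.StdSimplex.map_single _ _
  · funext α
    by_cases h : α.1 ≤ b <;> simp [map, guardOp_apply, h]
  · exact funext fun α => SubDist.map_mix f p _ _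

theorem eval_rename (f : X → Y) (t : (GCSig T).Term X) :
    (alg T Y).eval unit (t.rename f) = map f ((alg T X).eval unit t) := by
  rw [Alg.eval_rename, (isHom_map f).map_eval]
  simp only [map_unit]

theorem isFreeAlgebraConstruction (T : Type u) [Finite T] :
    (triple T).IsFreeAlgebraConstruction (GC T) where
  map_id X χ := funext fun α => by
    change (χ α).map (Option.map id) = χ α
    rw [Option.map_id, Convexity.StdSimplex.map_id]
  map_comp X Y Z f g χ := funext fun α => by
    change (χ α).map (Option.map (g ∘ f)) = ((χ α).map (Option.map f)).map (Option.map g)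
    rw [← Option.map_comp_map, Convexity.StdSimplex.map_comp]
  unit_natural X Y f x := map_unit f x
  alg_natural X Y f := isHom_map f
  satisfies X := satisfies_iff.2 (laws T X)
  existsUnique_extension X Y μ hμ f :=
    ⟨extend (satisfies_iff.1 hμ) f, ⟨isHom_extend _ f, extend_unit _ f⟩, fun k hk =>
      hom_ext (satisfies_iff.1 hμ) hk.1 (isHom_extend _ f) fun x =>
        (hk.2 x).trans (extend_unit _ f x).symm⟩

/-! ### Supports -/

theorem mem_supp {χ : GCFree T X} {x : X} :
    x ∈ supp X χ ↔ ∃ α, 0 < (χ α).weights (some x) := Set.mem_iUnion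

theorem supp_alg_subset (σ : GCOp T) (a : Fin ((GCSig T).ar σ) → GCFree T X) :
    supp X (alg T X σ a) ⊆ ⋃ i, supp X (a i) := by
  intro x hx
  obtain ⟨α, hα⟩ := mem_supp.1 hx
  rw [Set.mem_iUnion]
  cases σ with
  | zero =>
    have : (SubDist.diracBot : SubDist X).weights (some x) = 0 := by simp [SubDist.diracBot]
    exact absurd hα (this.symm ▸ lt_irrefl 0)
  | guard b =>
    change Fin 2 → GCFree T X at a
    change ∃ i : Fin 2, x ∈ supp X (a i)
    by_cases h : α.1 ≤ b
    · exact ⟨0, mem_supp.2 ⟨α, by simpa [alg, h] using hα⟩⟩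
    · exact ⟨1, mem_supp.2 ⟨α, by simpa [alg, h] using hα⟩⟩
  | conv p =>
    change Fin 2 → GCFree T X at a
    change ∃ i : Fin 2, x ∈ supp X (a i)
    change 0 < (SubDist.mix p (a 0 α) (a 1 α)).weights (some x) at hα
    rw [SubDist.weights_mix_apply] at hα
    by_contra! hne
    have h : ∀ i : Fin 2, (a i α).weights (some x) ≤ 0 := fun i =>
      not_lt.1 fun hi => hne i (mem_supp.2 ⟨α, hi⟩)
    exact hα.not_ge (add_nonpos (mul_nonpos_of_nonneg_of_nonpos p.2.1 (h 0))
      (mul_nonpos_of_nonneg_of_nonpos (sub_nonneg.2 p.2.2) (h 1)))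

/-- Needed for the unit law of the support: a union over no atoms would be empty. -/
instance [Finite T] : Nonempty (At T) := by
  obtain ⟨a, ha, -⟩ := (eq_bot_or_exists_atom_le (⊤ : BA T)).resolve_left BA.top_ne_bot
  exact ⟨⟨a, ha⟩⟩

theorem isSupport (T : Type u) [Finite T] : (triple T).IsSupport (fun X χ => supp X χ) where
  finite X χ := Set.finite_iUnion fun α =>
    ((χ α).weights.hasFiniteSupport.preimage (Option.some_injective X).injOn).subset
      fun x hx => (ne_of_gt hx : _)
  natural X Y f χ := by
    ext y
    refine mem_supp.trans ?_
    refine (exists_congr fun α => SubDist.weights_map_pos_iff f (χ α) y).trans ?_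
    constructor
    · rintro ⟨α, x, hx, e⟩
      exact ⟨x, mem_supp.2 ⟨α, hx⟩, e⟩
    · rintro ⟨x, hx, e⟩
      obtain ⟨α, hα⟩ := mem_supp.1 hx
      exact ⟨α, x, hα, e⟩
  unit X x := by
    classical
    ext y
    refine mem_supp.trans ?_
    change (∃ α : At T, 0 < (Finsupp.single (some x) (1 : ℝ)) (some y)) ↔ _
    rw [exists_const, Finsupp.single_apply]
    by_cases h : x = y <;> simp [h, eq_comm]
  op_subset X σ t := supp_alg_subset σ _

end GCFree

/-! ## Restricting subdistributions -/

namespace SubDist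

variable {X : Type v}

theorem mass_eq_sum (θ : SubDist X) (U : Set X) :
    θ.mass U = (θ.weights.some.subtypeDomain (· ∈ U)).sum fun _ r => r := by
  rw [mass, ← finsum_set_coe_eq_finsum_mem, Finsupp.sum]
  exact finsum_eq_sum_of_support_subset _ fun u hu => by simpa using hu

theorem mass_nonneg (θ : SubDist X) (U : Set X) : 0 ≤ θ.mass U := by
  rw [mass_eq_sum]
  exact Finset.sum_nonneg fun u _ => θ.weights_nonneg (some u.1)

theorem weights_none_add_mass_univ (θ : SubDist X) : θ.weights none + θ.mass Set.univ = 1 := by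
  rw [← θ.total, Finsupp.sum_option_index θ.weights _ (fun _ => rfl) fun _ _ _ => rfl, mass,
    finsum_mem_univ, Finsupp.sum]
  congr 1
  exact finsum_eq_sum_of_support_subset _ fun x hx => by simpa using hx

/-- The weight at `⊥` is what the total mass on `X` leaves of `1`. -/
theorem ext_some {θ ψ : SubDist X} (h : ∀ x, θ.weights (some x) = ψ.weights (some x)) :
    θ = ψ := by
  refine ext_weights fun o => ?_
  cases o with
  | none =>
    have hm : θ.mass Set.univ = ψ.mass Set.univ := by simp only [mass, h]
    have h₁ := θ.weights_none_add_mass_univ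
    have h₂ := ψ.weights_none_add_mass_univ
    linarith
  | some x => exact h x

theorem mass_add_mass (θ : SubDist X) {U V : Set X} (h : IsCompl U V) :
    θ.mass U + θ.mass V = θ.mass Set.univ := by
  have hfin : (Function.support fun x => θ.weights (some x)).Finite :=
    θ.weights.hasFiniteSupport.preimage (Option.some_injective X).injOn
  rw [mass, mass, mass, ← h.sup_eq_top.trans Set.top_eq_univ]
  exact (finsum_mem_union' h.disjoint (hfin.inter_of_right _) (hfin.inter_of_right _)).symm

/-- A subdistribution can be normalized on any part of its space. -/
theorem exists_normalize (θ : SubDist X) (U : Set X) :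
    ∃ ψ : SubDist U, ∀ u : U, θ.mass U * ψ.weights (some u) = θ.weights (some u.1) := by
  set G := θ.weights.some.subtypeDomain (· ∈ U) with hG
  have hGnn : ∀ u, 0 ≤ G u := fun u => θ.weights_nonneg (some u.1)
  rcases (θ.mass_nonneg U).eq_or_lt with h | h
  -- When `U` has mass zero, all weights on `U` vanish and any distribution would do.
  · refine ⟨diracBot, fun u => ?_⟩
    rw [← h, zero_mul]
    by_contra hne
    have : 0 < G.sum fun _ r => r :=
      Finset.sum_pos' (fun u _ => hGnn u) ⟨u, Finsupp.mem_support_iff.2 (Ne.symm hne),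
        (hGnn u).lt_of_ne hne⟩
    rw [← mass_eq_sum, ← h] at this
    exact lt_irrefl _ this
  · refine ⟨⟨(((θ.mass U)⁻¹) • G).embDomain .some, fun o => ?_, ?_⟩, fun u => ?_⟩
    · cases o with
      | none => exact (Finsupp.embDomain_of_notMem_range _ _ _ (by simp)).ge
      | some u =>
        refine (mul_nonneg (inv_nonneg.2 h.le) (hGnn u)).trans_eq ?_
        exact (Finsupp.embDomain_apply_self .some (((θ.mass U)⁻¹) • G) u).symm
    · rw [Finsupp.sum_embDomain, Finsupp.sum_smul_index fun _ => rfl, ← Finsupp.mul_sum,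
        ← mass_eq_sum, inv_mul_cancel₀ h.ne']
    · have : ((((θ.mass U)⁻¹) • G).embDomain .some) (some u) = (θ.mass U)⁻¹ * G u :=
        Finsupp.embDomain_apply_self .some _ u
      change θ.mass U * ((((θ.mass U)⁻¹) • G).embDomain .some) (some u) = _
      rw [this, mul_inv_cancel_left₀ h.ne']
      rfl

open Classical in
theorem mass_mul_weights_map {θ : SubDist X} {U : Set X} {ψ : SubDist U}
    (h : ∀ u : U, θ.mass U * ψ.weights (some u) = θ.weights (some u.1)) (x : X) :
    θ.mass U * (ψ.map (Option.map Subtype.val)).weights (some x) =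
      if x ∈ U then θ.weights (some x) else 0 := by
  rw [Convexity.StdSimplex.weights_map]
  split_ifs with hx
  · rw [← h ⟨x, hx⟩]
    congr 1
    exact Finsupp.mapDomain_apply (Option.map_injective Subtype.val_injective) _ (some ⟨x, hx⟩)
  · rw [Finsupp.mapDomain_of_notMem_range, mul_zero]
    rintro ⟨o, ho⟩
    obtain ⟨u, -, rfl⟩ := Option.map_eq_some_iff.1 ho
    exact hx u.2

end SubDist

/-! ## Malleability -/

namespace GCFree

open Sig GC

variable {T : Type u} {X : Type v}

/-- Evaluation of a term is the substitution of its values at generators. -/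
theorem weights_eval {ι : Type w} [Fintype ι] (e : ι → GCFree T X) (s : (GCSig T).Term ι)
    (α : At T) (x : X) :
    ((alg T X).eval e s α).weights (some x) =
      ∑ i, ((alg T ι).eval unit s α).weights (some i) * (e i α).weights (some x) := by
  classical
  induction s with
  | var i => simp [Alg.eval, unit, SubDist.dirac, Finsupp.single_apply]
  | op σ args ih =>
    cases σ with
    | zero => simp [Alg.eval, alg, SubDist.diracBot]
    | guard b =>
      have h₀ := ih (0 : Fin 2)
      have h₁ := ih (1 : Fin 2)
      by_cases h : α.1 ≤ b
      · simpa [Alg.eval, alg, h] using h₀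
      · simpa [Alg.eval, alg, h] using h₁
    | conv p =>
      have h₀ := ih (0 : Fin 2)
      have h₁ := ih (1 : Fin 2)
      simp only [Alg.eval, alg, SubDist.weights_mix_apply]
      rw [h₀, h₁, Finset.mul_sum, Finset.mul_sum, ← Finset.sum_add_distrib]
      exact Finset.sum_congr rfl fun i _ => by ring

/-- At each atom, `θ = r (p ψ₁ + (1 - p) ψ₂) + (1 - r) δ_⊥` with `ψ₁`, `ψ₂` the normalizations of
`θ` on `U` and `V`. The three families are realized by terms, and completeness makes the identity
derivable. -/
theorem exists_split [Finite T] {U V : Set X} (hUV : IsCompl U V) (t : (GCSig T).Term X) :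
    ∃ (t₁ : (GCSig T).Term U) (t₂ : (GCSig T).Term V) (s : (GCSig T).Term (Fin 2)),
      (GC T).Derives t (s.split t₁ t₂) ∧
      ∀ α : At T, ∃ r p : unitInterval,
        (r : ℝ) = ((alg T X).eval unit t α).mass Set.univ ∧
        (0 < (r : ℝ) → (p : ℝ) = ((alg T X).eval unit t α).mass U / r) ∧
        (alg T (Fin 2)).eval unit s α =
          SubDist.mix r (SubDist.mix p (SubDist.dirac 0) (SubDist.dirac 1))
            SubDist.diracBot := by
  classical
  set χ := (alg T X).eval unit t with hχ
  choose ψ₁ hψ₁ using fun α => (χ α).exists_normalize U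
  choose ψ₂ hψ₂ using fun α => (χ α).exists_normalize V
  have hr : ∀ α, (χ α).mass Set.univ ∈ unitInterval := fun α =>
    ⟨(χ α).mass_nonneg _, by
      have := (χ α).weights_none_add_mass_univ
      have := (χ α).weights_nonneg none
      linarith⟩
  have hadd := fun α => (χ α).mass_add_mass hUV
  have hle : ∀ α, (χ α).mass U ≤ (χ α).mass Set.univ := fun α => by
    have := (χ α).mass_nonneg V
    linarith [hadd α]
  -- If the total mass is zero, the quotient takes the value `0`, which is harmless as it is later
  -- multiplied by that mass.
  have hp : ∀ α, (χ α).mass U / (χ α).mass Set.univ ∈ unitInterval := fun α =>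
    ⟨div_nonneg ((χ α).mass_nonneg _) ((χ α).mass_nonneg _),
      div_le_one_of_le₀ (hle α) ((χ α).mass_nonneg _)⟩
  obtain ⟨t₁, ht₁⟩ := exists_eval_eq (T := T) ψ₁
  obtain ⟨t₂, ht₂⟩ := exists_eval_eq (T := T) ψ₂
  obtain ⟨s, hs⟩ := exists_eval_eq (T := T) (X := Fin 2) fun α =>
    SubDist.mix ⟨_, hr α⟩ (SubDist.mix ⟨_, hp α⟩ (SubDist.dirac 0) (SubDist.dirac 1))
      SubDist.diracBot
  refine ⟨t₁, t₂, s, derives_of_eval_eq ?_, fun α =>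
    ⟨⟨_, hr α⟩, ⟨_, hp α⟩, rfl, fun _ => rfl, congrFun hs α⟩⟩
  funext α
  refine SubDist.ext_some fun x => ?_
  have hrp : (χ α).mass Set.univ * ((χ α).mass U / (χ α).mass Set.univ) = (χ α).mass U :=
    mul_div_cancel_of_imp' fun h => le_antisymm (h ▸ hle α) ((χ α).mass_nonneg U)
  have h₁ := SubDist.mass_mul_weights_map (hψ₁ α) x
  have h₂ := SubDist.mass_mul_weights_map (hψ₂ α) x
  have hx : (if x ∈ U then (χ α).weights (some x) else 0) +
      (if x ∈ V then (χ α).weights (some x) else 0) = (χ α).weights (some x) := by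
    have : x ∈ V ↔ x ∉ U := by rw [← hUV.compl_eq, Set.mem_compl_iff]
    by_cases h : x ∈ U <;> simp [this, h]
  rw [Term.split, Alg.eval_subst, weights_eval _ s, Fin.sum_univ_two, hs, ← hχ, ← hx, ← h₁, ← h₂]
  simp only [Matrix.cons_val_zero, Matrix.cons_val_one, eval_rename, ht₁, ht₂,
    SubDist.weights_mix_apply]
  have d₀₀ : (SubDist.dirac 0 : SubDist (Fin 2)).weights (some 0) = 1 := by simp [SubDist.dirac]
  have d₀₁ : (SubDist.dirac 0 : SubDist (Fin 2)).weights (some 1) = 0 := by simp [SubDist.dirac]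
  have d₁₀ : (SubDist.dirac 1 : SubDist (Fin 2)).weights (some 0) = 0 := by simp [SubDist.dirac]
  have d₁₁ : (SubDist.dirac 1 : SubDist (Fin 2)).weights (some 1) = 1 := by simp [SubDist.dirac]
  have db : ∀ i, (SubDist.diracBot : SubDist (Fin 2)).weights (some i) = 0 := fun i => by
    simp [SubDist.diracBot]
  rw [d₀₀, d₀₁, d₁₀, d₁₁, db, db]
  simp only [map]
  -- The coefficients of `ψ₁` and `ψ₂` match because `r p` is the mass of `U` and `r (1 - p)` that
  -- of `V`.
  linear_combination
    (((ψ₂ α).map (Option.map Subtype.val)).weights (some x) -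
      ((ψ₁ α).map (Option.map Subtype.val)).weights (some x)) * hrp +
      ((ψ₂ α).map (Option.map Subtype.val)).weights (some x) * hadd α

end GCFree

/-! ## Failure of skew associativity -/

namespace GCFree

open Sig GC

variable {T : Type u}

theorem eval_bin_guard {A : Type v} {X : Type w} (μ : (GCSig T).Alg A) (e : X → A) (b : BA T)
    (h : (GCSig T).ar (.guard b) = 2) (t s : (GCSig T).Term X) :
    μ.eval e (.bin (.guard b) h t s) = guardOp μ b (μ.eval e t) (μ.eval e s) :=
  alg_guard μ b _

theorem eval_bin_conv {A : Type v} {X : Type w} (μ : (GCSig T).Alg A) (e : X → A)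
    (p : unitInterval) (h : (GCSig T).ar (.conv p) = 2) (t s : (GCSig T).Term X) :
    μ.eval e (.bin (.conv p) h t s) = convOp μ p (μ.eval e t) (μ.eval e s) :=
  alg_conv μ p _

theorem not_skewAssociative [Finite T] [Nonempty T] : ¬ (GC T).SkewAssociative := by
  intro hskew
  let a : T := Classical.arbitrary T
  let b : BA T := BA.mk (.test a)
  obtain ⟨α, hα, hαb⟩ := (eq_bot_or_exists_atom_le b).resolve_left (BA.mk_test_ne_bot a)
  obtain ⟨β, hβ, hβb⟩ := (eq_bot_or_exists_atom_le bᶜ).resolve_left (BA.compl_mk_test_ne_bot a)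
  rw [le_compl_iff_disjoint_right, ← hβ.not_le_iff_disjoint] at hβb
  let half : unitInterval := ⟨1 / 2, by norm_num, by norm_num⟩
  obtain ⟨τ₁, τ₂, k₁, k₂, hd⟩ := hskew (.conv half) (.guard b) rfl rfl
  have key := hd.eval_eq (satisfies_iff.2 (laws T ℕ)) unit
  rw [eval_bin_conv, eval_bin_guard] at key
  have δ : ∀ m n : ℕ, (SubDist.dirac m).weights (some n) = if m = n then 1 else 0 := fun m n => by
    simp [SubDist.dirac, Finsupp.single_apply]
  -- The weight of `z` on the left-hand side is `0` at `α` and `1/2` at `β`.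
  have hα₂ := congrArg (fun χ : GCFree T ℕ => (χ ⟨α, hα⟩).weights (some 2)) key
  have hβ₂ := congrArg (fun χ : GCFree T ℕ => (χ ⟨β, hβ⟩).weights (some 2)) key
  -- The variable `z` does not occur in `τ₂(x, y)`, so its weight comes from the outer operation
  -- alone.
  have hD : ∀ γ : At T,
      ((alg T ℕ).eval unit (.bin τ₂ k₂ (.var 0) (.var 1)) γ).weights (some 2) = 0 := by
    intro γ
    cases τ₂ with
    | zero => exact absurd k₂ (by simp)
    | guard c =>
      rw [eval_bin_guard, guardOp_apply]
      split_ifs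
      exacts [(δ 0 2).trans (if_neg (by norm_num)), (δ 1 2).trans (if_neg (by norm_num))]
    | conv p =>
      rw [eval_bin_conv, convOp_apply, SubDist.weights_mix_apply]
      simp [unit, δ]
  simp only [convOp_apply, guardOp_apply, SubDist.weights_mix_apply, if_pos hαb, if_neg hβb,
    GC.eval_var, unit, δ] at hα₂ hβ₂
  cases τ₁ with
  | zero => exact absurd k₁ (by simp)
  -- A guard selects one argument, so the weight of `z` at `β` would be `0` or `1`.
  | guard c =>
    rw [eval_bin_guard, guardOp_apply] at hβ₂
    by_cases hc : β ≤ c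
    · rw [if_pos hc, hD] at hβ₂
      norm_num [half] at hβ₂
    · rw [if_neg hc] at hβ₂
      change _ = (SubDist.dirac 2).weights (some 2) at hβ₂
      rw [δ] at hβ₂
      norm_num [half] at hβ₂
  -- Here the weight of `z` is `1 - p` at both atoms, which cannot be both `0` and `1/2`.
  | conv p =>
    rw [eval_bin_conv, convOp_apply, SubDist.weights_mix_apply] at hα₂ hβ₂
    change _ = _ * ((alg T ℕ).eval unit (.bin τ₂ k₂ (.var 0) (.var 1)) _).weights (some 2) +
      _ * (SubDist.dirac 2).weights (some 2) at hα₂ hβ₂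
    rw [hD, δ] at hα₂ hβ₂
    norm_num [half] at hα₂ hβ₂
    linarith

end GCFree

theorem mainTheorem7 (T : Type u) [Finite T] :
    -- `GC` is supported, via the union over the atoms of the supports of the subdistributions
    ((GCFree.triple T).IsFreeAlgebraConstruction (GC T) ∧
      (GCFree.triple T).IsSupport (fun X χ => GCFree.supp X χ)) ∧
    Sig.Eqns.Supported.{u, u} (GC T) ∧
    -- `GC` is malleable
    Sig.Eqns.Malleable.{u, v} (GC T) ∧
    -- the splitting term is given atom-wise by the total mass `r` and the `U`-proportion `p`
    (∀ (X : Type v) (U V : Set X), IsCompl U V → ∀ t : (GCSig T).Term X,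
      ∃ (t₁ : (GCSig T).Term U) (t₂ : (GCSig T).Term V) (s : (GCSig T).Term (Fin 2)),
        (GC T).Derives t (s.split t₁ t₂) ∧
        ∀ α : At T, ∃ r p : unitInterval,
          (r : ℝ) = ((GCFree.alg T X).eval GCFree.unit t α).mass Set.univ ∧
          (0 < (r : ℝ) →
            (p : ℝ) = ((GCFree.alg T X).eval GCFree.unit t α).mass U / r) ∧
          (GCFree.alg T (Fin 2)).eval GCFree.unit s α =
            SubDist.mix r (SubDist.mix p (SubDist.dirac 0) (SubDist.dirac 1))
              SubDist.diracBot) ∧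
    -- `GC` is not skew associative, as soon as there is a primitive test
    (Nonempty T → ¬ (GC T).SkewAssociative) :=
  ⟨⟨GCFree.isFreeAlgebraConstruction T, GCFree.isSupport T⟩,
    ⟨GCFree.triple T, fun X χ => GCFree.supp X χ, GCFree.isFreeAlgebraConstruction T,
      GCFree.isSupport T⟩,
    fun _ _ _ hUV t =>
      let ⟨t₁, t₂, s, h, _⟩ := GCFree.exists_split hUV t
      ⟨t₁, t₂, s, h⟩,
    fun _ _ _ hUV t => GCFree.exists_split hUV t,
    fun _ => GCFree.not_skewAssociative⟩
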